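/- Let $\nu>0$, $T>0$, and let $\chi_c\in C_0^\infty(\mathbb R)$. Put $H=L^2(\mathbb R)$, $V=H^1(\mathbb R)$ and $W(V)=\{y\in L^2(0,T;V)\mid \partial_t y\in L^2(0,T;V^*)\}$ with $\|y\|_{W(V)}^2=\|y\|_{L^2(0,T;V)}^2+\|\partial_t y\|_{L^2(0,T;V^*)}^2$; values $y(t)\in H$ of $y\in W(V)$ are those of its representative in $C([0,T];H)$. For $u\in H^1(0,T)$, $y_0\in V$ and $C>0$ put $$C_{state}=C\,(\|u\|_{L^2(0,T)}+\|y_0\|_V)^2\exp\big(C(\|u\|_{L^2(0,T)}^2+\|y_0\|_H^2)\big).$$ There is a constant $C_0>0$, depending only on $\nu,T,\chi_c$, such that for every $C\ge C_0$ and every $\delta>0$ there is a constant $c>0$, depending only on $\nu,T,\chi_c,C,\delta$, with the following property. Let $y_0\in V$ and $y_d\in H$ have bounded support, let $u\in H^1(0,T)$ with $u_l\le u\le u_u$ a.e. for some real $u_l,u_u$, and suppose $\|u\|_{L^2(0,T)}+\|y_0\|_V\ge\delta$. Let $\delta_\varepsilon(x)=\varepsilon^{-1}\zeta(\varepsilon^{-1}x)$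 with $\varepsilon>0$, where $\zeta\in C^\infty(\mathbb R)\cap L^1(\mathbb R)$ satisfies, for some integer $r\ge1$, $\int\zeta=1$, $\int x^k\zeta(x)\,dx=0$ for $1\le k\le r-1$ and $\int|x|^r|\zeta(x)|\,dx<\infty$. Let $N\in\mathbb N$, $X\in\mathbb R^N$, and let $(y_h,\Phi)\in (W(V)\cap L^\infty(0,T;V))\times H^1(0,T)^N$ solve the discrete state problem: for some functions $\alpha_1,\dots,\alpha_N$ on $(0,T)$, $$y_h(x,t)=\sum_{i=1}^N\alpha_i(t)\,\delta_\varepsilon(x-\Phi_i(t)),\qquad \partial_t\Phi_i(t)=y_h(\Phi_i(t),t),\qquad \Phi_i(0)=X_i,$$ and for a.e. $t\in(0,T)$ and all $\phi\in V$, $\psi\in H$, $$\langle\partial_t y_h(t),\phi\rangle_{V^*,V}+\langle y_h(t)\partial_x y_h(t),\phi\rangle_H+\nu\langle\partial_x y_h(t),\partial_x\phi\rangle_H=\langle\chi_c u(t),\phi\rangle_H,\qquad \langle y_h(0),\psi\rangle_H=\langle y_0,\psi\rangle_H .$$ Let $p_h\in W(V)$ solve the adjoint equation: for a.e. $t\in(0,T)$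 and all $\phi\in V$, $\psi\in H$, $$\langle\partial_t p_h(t),\phi\rangle_{V^*,V}+\langle y_h(t)\partial_x p_h(t),\phi\rangle_H-\nu\langle\partial_x p_h(t),\partial_x\phi\rangle_H=0,\qquad \langle p_h(T),\psi\rangle_H=\langle y_d-y_h(T),\psi\rangle_H$$ (for instance, but not necessarily, $p_h(x,t)=\sum_i\beta_i(t)\delta_\varepsilon(x-\Phi_i(t))$). Then $$\|p_h\|_{W(V)}\le c\,(C_{state}^4+C_{state}^2)\,\|y_h(T)-y_d\|_H .$$ -/

import Mathlib

open MeasureTheory Set Filter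
open scoped ContDiff ENNReal RealInnerProductSpace

noncomputable section

namespace BurgersControl

/-! ## Weak derivatives and first order Sobolev spaces on open subsets of the line -/

/-- `g` is the weak derivative of `f` on the open set `Ω ⊆ ℝ`: one integrates by parts against
smooth functions whose compact support lies in `Ω`. -/
def HasWeakDerivOn (Ω : Set ℝ) (f g : ℝ → ℝ) : Prop :=
  ∀ φ : ℝ → ℝ, ContDiff ℝ ∞ φ → HasCompactSupport φ → tsupport φ ⊆ Ω →
    ∫ x in Ω, f x * deriv φ x = -∫ x in Ω, g x * φ x

theorem integrable_mul_test {Ω : Set ℝ} {f φ : ℝ → ℝ} (hf : MemLp f 2 (volume.restrict Ω))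
    (hφ : Continuous φ) (hc : HasCompactSupport φ) :
    Integrable (fun x => f x * φ x) (volume.restrict Ω) :=
  MemLp.integrable_mul (p := 2) (q := 2) hf (hφ.memLp_of_hasCompactSupport hc)

theorem HasWeakDerivOn.congr {Ω : Set ℝ} {f g f' g' : ℝ → ℝ} (h : HasWeakDerivOn Ω f g)
    (hf : f' =ᵐ[volume.restrict Ω] f) (hg : g' =ᵐ[volume.restrict Ω] g) :
    HasWeakDerivOn Ω f' g' := by
  intro φ h1 h2 h3
  have e1 : ∫ x in Ω, f' x * deriv φ x = ∫ x in Ω, f x * deriv φ x :=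
    integral_congr_ae (by filter_upwards [hf] with x hx; rw [hx])
  have e2 : ∫ x in Ω, g' x * φ x = ∫ x in Ω, g x * φ x :=
    integral_congr_ae (by filter_upwards [hg] with x hx; rw [hx])
  rw [e1, e2, h φ h1 h2 h3]

theorem HasWeakDerivOn.add {Ω : Set ℝ} {f g f' g' : ℝ → ℝ}
    (h : HasWeakDerivOn Ω f g) (h' : HasWeakDerivOn Ω f' g')
    (hf : MemLp f 2 (volume.restrict Ω)) (hg : MemLp g 2 (volume.restrict Ω))
    (hf' : MemLp f' 2 (volume.restrict Ω)) (hg' : MemLp g' 2 (volume.restrict Ω)) :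
    HasWeakDerivOn Ω (f + f') (g + g') := by
  intro φ h1 h2 h3
  have hd : Continuous (deriv φ) := h1.continuous_deriv (by simp)
  simp only [Pi.add_apply, add_mul]
  rw [integral_add (integrable_mul_test hf hd h2.deriv) (integrable_mul_test hf' hd h2.deriv),
    integral_add (integrable_mul_test hg h1.continuous h2)
      (integrable_mul_test hg' h1.continuous h2), h φ h1 h2 h3, h' φ h1 h2 h3, neg_add]

theorem HasWeakDerivOn.smul {Ω : Set ℝ} {f g : ℝ → ℝ} (h : HasWeakDerivOn Ω f g) (a : ℝ) :
    HasWeakDerivOn Ω (a • f) (a • g) := by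
  intro φ h1 h2 h3
  simp only [Pi.smul_apply, smul_eq_mul, mul_assoc]
  rw [integral_const_mul, integral_const_mul, h φ h1 h2 h3, mul_neg]

theorem hasWeakDerivOn_zero {Ω : Set ℝ} : HasWeakDerivOn Ω 0 0 := by
  intro φ _ _ _
  simp

/-- The Lebesgue space `L²(Ω)`. -/
abbrev L2 (Ω : Set ℝ) : Type := Lp ℝ 2 (volume.restrict Ω)

/-- The Sobolev space `H¹(Ω)`, as the space of pairs `(f, f')` of a function in `L²(Ω)` and its
weak derivative in `L²(Ω)`. The norm is `‖f‖² + ‖f'‖²` under the square root. -/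
def H1Submodule (Ω : Set ℝ) : Submodule ℝ (WithLp 2 (L2 Ω × L2 Ω)) where
  carrier := {w | HasWeakDerivOn Ω w.fst w.snd}
  add_mem' hv hw :=
    (hv.add hw (Lp.memLp _) (Lp.memLp _) (Lp.memLp _) (Lp.memLp _)).congr
      (Lp.coeFn_add _ _) (Lp.coeFn_add _ _)
  zero_mem' := hasWeakDerivOn_zero.congr (Lp.coeFn_zero _ _ _) (Lp.coeFn_zero _ _ _)
  smul_mem' a _ hw := (HasWeakDerivOn.smul hw a).congr (Lp.coeFn_smul _ _) (Lp.coeFn_smul _ _)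

/-- The Sobolev space `H¹(Ω)`. -/
def H1 (Ω : Set ℝ) : Type := H1Submodule Ω

instance (Ω : Set ℝ) : NormedAddCommGroup (H1 Ω) :=
  inferInstanceAs (NormedAddCommGroup (H1Submodule Ω))

instance (Ω : Set ℝ) : InnerProductSpace ℝ (H1 Ω) :=
  inferInstanceAs (InnerProductSpace ℝ (H1Submodule Ω))

/-- The underlying function in `L²(Ω)` of an element of `H¹(Ω)`. -/
def toL2 {Ω : Set ℝ} : H1 Ω →L[ℝ] L2 Ω :=
  (WithLp.fstL 2 ℝ (L2 Ω) (L2 Ω)).comp (H1Submodule Ω).subtypeL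

/-- The weak derivative of an element of `H¹(Ω)`. -/
def weakDeriv {Ω : Set ℝ} : H1 Ω →L[ℝ] L2 Ω :=
  (WithLp.sndL 2 ℝ (L2 Ω) (L2 Ω)).comp (H1Submodule Ω).subtypeL

/-- `H = L²(ℝ)`. -/
abbrev H : Type := L2 univ

/-- `V = H¹(ℝ)`. -/
abbrev V : Type := H1 univ

/-- The dual space of `V`, with the operator norm. -/
abbrev VDual : Type := StrongDual ℝ V

/-! ## Functions of time -/

/-- Lebesgue measure on the time interval `(0, T)`. -/
abbrev timeMeasure (T : ℝ) : Measure ℝ := volume.restrict (Ioo 0 T)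

theorem memLp_inner_toL2 {T : ℝ} (y : Lp V 2 (timeMeasure T)) (v : V) :
    MemLp (fun t => ⟪toL2 (y t), toL2 v⟫) 2 (timeMeasure T) := by
  let L : V →L[ℝ] ℝ := (innerSL ℝ (toL2 v)).comp (toL2 (Ω := univ))
  refine (L.comp_memLp' (Lp.memLp y)).ae_eq
    (Eventually.of_forall fun t => ?_)
  exact real_inner_comm (toL2 (y t)) (toL2 v)

theorem memLp_apply {T : ℝ} (g : Lp VDual 2 (timeMeasure T)) (v : V) :
    MemLp (fun t => g t v) 2 (timeMeasure T) :=
  (ContinuousLinearMap.apply ℝ ℝ v).comp_memLp' (Lp.memLp g)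

/-- The space `W(V) = {y ∈ L²(0,T;V) | ∂ₜy ∈ L²(0,T;V*)}`, as the space of pairs `(y, ∂ₜy)`. Here
`H` is identified with its dual, so that `∂ₜy = g` means that for every `v` in `V` the scalar
function `⟨y(t), v⟩_H` has the weak derivative `⟨g(t), v⟩_{V*,V}` on `(0, T)`. The squared norm is
`‖y‖²` in `L²(V)` plus `‖∂ₜy‖²` in `L²(V*)`. -/
def WSubmodule (T : ℝ) :
    Submodule ℝ (WithLp 2 (Lp V 2 (timeMeasure T) × Lp VDual 2 (timeMeasure T))) where
  carrier := {w | ∀ v : V, HasWeakDerivOn (Ioo 0 T)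
    (fun t => ⟪toL2 (w.fst t), toL2 v⟫) (fun t => w.snd t v)}
  add_mem' {y z} hy hz v := by
    refine ((hy v).add (hz v) (memLp_inner_toL2 _ v) (memLp_apply _ v) (memLp_inner_toL2 _ v)
      (memLp_apply _ v)).congr ?_ ?_
    · filter_upwards [Lp.coeFn_add y.fst z.fst] with t ht
      simp only [WithLp.add_fst, ht, Pi.add_apply]
      exact inner_add_left _ _ _
    · filter_upwards [Lp.coeFn_add y.snd z.snd] with t ht
      simp only [WithLp.add_snd, ht, Pi.add_apply, add_apply]
  zero_mem' v := by
    refine hasWeakDerivOn_zero.congr ?_ ?_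
    · filter_upwards [Lp.coeFn_zero V 2 (timeMeasure T)] with t ht
      simp only [WithLp.zero_fst, ht, Pi.zero_apply]
      exact inner_zero_left _
    · filter_upwards [Lp.coeFn_zero VDual 2 (timeMeasure T)] with t ht
      simp only [WithLp.zero_snd, ht, Pi.zero_apply, zero_apply]
  smul_mem' a y hy v := by
    refine ((hy v).smul a).congr ?_ ?_
    · filter_upwards [Lp.coeFn_smul a y.fst] with t ht
      simp only [WithLp.smul_fst, ht, Pi.smul_apply]
      exact real_inner_smul_left _ _ _
    · filter_upwards [Lp.coeFn_smul a y.snd] with t ht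
      simp only [WithLp.smul_snd, ht, Pi.smul_apply, smul_apply]

/-- The space `W(V)`. -/
def W (T : ℝ) : Type := WSubmodule T

instance (T : ℝ) : NormedAddCommGroup (W T) :=
  inferInstanceAs (NormedAddCommGroup (WSubmodule T))

instance (T : ℝ) : NormedSpace ℝ (W T) :=
  inferInstanceAs (NormedSpace ℝ (WSubmodule T))

/-- `y(t) ∈ V`, for almost every `t` in `(0, T)`. -/
def val {T : ℝ} (y : W T) : ℝ → V := y.1.fst

/-- `∂ₜy(t) ∈ V*`, for almost every `t` in `(0, T)`. -/
def timeDeriv {T : ℝ} (y : W T) : ℝ → VDual := y.1.snd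

/-- The function `f`, given almost everywhere on `(0, T)`, has a representative which is continuous
on `[0, T]` and takes the value `a` at `t`. (Used for `W(V) ⊆ C([0,T];H)` and
`H¹(0,T) ⊆ C([0,T])`.) -/
def HasValueAt {E : Type*} [TopologicalSpace E] (T : ℝ) (f : ℝ → E) (t : ℝ) (a : E) : Prop :=
  ∃ g : ℝ → E, ContinuousOn g (Icc 0 T) ∧ g =ᵐ[timeMeasure T] f ∧ g t = a

/-- `a ∈ H` is the value `y(t)` of `y ∈ W(V)` at the time `t ∈ [0, T]`. -/
def ValueAt {T : ℝ} (y : W T) (t : ℝ) (a : H) : Prop :=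
  HasValueAt T (fun s => toL2 (val y s)) t a

/-! ## The data of the control problem -/

/-- The function vanishes (almost everywhere) outside a bounded interval. -/
def HasBoundedSupport (f : H) : Prop :=
  ∃ a b : ℝ, ∀ᵐ x : ℝ, x ∉ Icc a b → f x = 0

/-- The admissible controls: `u ∈ H¹(0,T)` with `u_l ≤ u ≤ u_u` almost everywhere. -/
def admissible (T ul uu : ℝ) : Set (H1 (Ioo 0 T)) :=
  {u | ∀ᵐ t ∂(timeMeasure T), ul ≤ toL2 u t ∧ toL2 u t ≤ uu}

/-- `C_state = C (‖u‖_{L²(0,T)} + ‖y₀‖_V)² exp (C (‖u‖²_{L²(0,T)} + ‖y₀‖²_H))`. -/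
def stateConst {T : ℝ} (C : ℝ) (u : H1 (Ioo 0 T)) (y₀ : V) : ℝ :=
  C * (‖toL2 u‖ + ‖y₀‖) ^ 2 * Real.exp (C * (‖toL2 u‖ ^ 2 + ‖toL2 y₀‖ ^ 2))

/-! ## The particle discretisation -/

/-- A smooth kernel generating a Dirac sequence, with the moment conditions of order `r ≥ 1`. -/
structure IsKernel (r : ℕ) (ζ : ℝ → ℝ) : Prop where
  one_le : 1 ≤ r
  smooth : ContDiff ℝ ∞ ζ
  integrable : Integrable ζ
  integral_eq_one : ∫ x, ζ x = 1
  moment_eq_zero : ∀ k : ℕ, 1 ≤ k → k ≤ r - 1 → ∫ x, x ^ k * ζ x = 0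
  moment_integrable : Integrable fun x => |x| ^ r * |ζ x|

/-- `δ_ε(x) = ε⁻¹ ζ(ε⁻¹ x)`. -/
def mollifier (ζ : ℝ → ℝ) (ε x : ℝ) : ℝ := ε⁻¹ * ζ (ε⁻¹ * x)

/-- The particle sum `∑ᵢ αᵢ(t) δ_ε(x - Φᵢ(t))`, with weights and positions at a fixed time. -/
def particleSum {N : ℕ} (ζ : ℝ → ℝ) (ε : ℝ) (α Φ : Fin N → ℝ) (x : ℝ) : ℝ :=
  ∑ i, α i * mollifier ζ ε (x - Φ i)

/-- `(y, Φ) ∈ (W(V) ∩ L^∞(0,T;V)) × H¹(0,T)^N` solves the discrete state problem with control `u`,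
initial value `y₀` and initial particle positions `X`. -/
structure IsDiscreteState {N : ℕ} {T : ℝ} (ν : ℝ) (χ : ℝ → ℝ) (ζ : ℝ → ℝ) (ε : ℝ)
    (X : Fin N → ℝ) (y₀ : V) (u : H1 (Ioo 0 T)) (y : W T) (Φ : Fin N → H1 (Ioo 0 T)) : Prop where
  /-- `y ∈ L^∞(0,T;V)` -/
  memLp_top : MemLp (val y) ⊤ (timeMeasure T)
  /-- `y(x,t) = ∑ᵢ αᵢ(t) δ_ε(x - Φᵢ(t))` and `∂ₜΦᵢ(t) = y(Φᵢ(t),t)` -/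
  particle : ∃ α : Fin N → ℝ → ℝ, ∀ᵐ t ∂(timeMeasure T),
    (∀ᵐ x : ℝ, toL2 (val y t) x
      = particleSum ζ ε (fun i => α i t) (fun i => toL2 (Φ i) t) x) ∧
    ∀ j, weakDeriv (Φ j) t
      = particleSum ζ ε (fun i => α i t) (fun i => toL2 (Φ i) t) (toL2 (Φ j) t)
  /-- `Φᵢ(0) = Xᵢ` -/
  particle_init : ∀ i, HasValueAt T (toL2 (Φ i)) 0 (X i)
  /-- `⟨∂ₜy,φ⟩ + ⟨y ∂ₓy,φ⟩ + ν ⟨∂ₓy,∂ₓφ⟩ = ⟨χ u(t),φ⟩` for almost every `t` and all `φ ∈ V` -/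
  equation : ∀ᵐ t ∂(timeMeasure T), ∀ φ : V,
    timeDeriv y t φ + (∫ x, toL2 (val y t) x * weakDeriv (val y t) x * toL2 φ x)
      + ν * ⟪weakDeriv (val y t), weakDeriv φ⟫
      = toL2 u t * ∫ x, χ x * toL2 φ x
  /-- `⟨y(0),ψ⟩ = ⟨y₀,ψ⟩` for all `ψ ∈ H` -/
  init : ∃ y0 : H, ValueAt y 0 y0 ∧ ∀ ψ : H, ⟪y0, ψ⟫ = ⟪toL2 y₀, ψ⟫

/-- `p ∈ W(V)` solves the adjoint equation for the state `y`, where `yT = y(T)` and `yd` is the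
desired state. -/
structure IsDiscreteAdjoint {T : ℝ} (ν : ℝ) (yd yT : H) (y p : W T) : Prop where
  /-- `⟨∂ₜp,φ⟩ + ⟨y ∂ₓp,φ⟩ - ν ⟨∂ₓp,∂ₓφ⟩ = 0` for almost every `t` and all `φ ∈ V` -/
  equation : ∀ᵐ t ∂(timeMeasure T), ∀ φ : V,
    timeDeriv p t φ + (∫ x, toL2 (val y t) x * weakDeriv (val p t) x * toL2 φ x)
      - ν * ⟪weakDeriv (val p t), weakDeriv φ⟫ = 0
  /-- `⟨p(T),ψ⟩ = ⟨yd - y(T),ψ⟩` for all `ψ ∈ H` -/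
  terminal : ∃ pT : H, ValueAt p T pT ∧ ∀ ψ : H, ⟪pT, ψ⟫ = ⟪yd - yT, ψ⟫

end BurgersControl

end

open scoped Topology

noncomputable section

namespace BurgersControl

/-! ## Absolutely continuous functions and primitives -/

/-! The estimate comes from energy arguments for the two weak equations. Testing the state equation
with `y(t)` removes the convection term, because `∫ y² ∂ₓy = 0` on the line. Hence `‖y(t)‖_H²` and
`2ν ∫ ‖∂ₓy‖²` are both at most `R = 2‖y₀‖_H² + 4Tκ²‖u‖²`, where `κ` is the `L²` norm of `χ`
(`state_energy_estimate`).

Testing the adjoint equation with `p(t)` leaves `∫ y ∂ₓp p`, which the embedding of `H¹(ℝ)` into the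
bounded functions and Young's inequality control by part of the dissipation and `(4/ν)‖y‖_V²‖p‖_H²`.
Backward Gronwall then bounds `p` by its terminal value times an exponential of a multiple of `R`
(`adjoint_energy_estimate`). The equation itself bounds `∂ₜp` in `V*` (`norm_timeDeriv_sq_le`), and
`adjoint_norm_sq_le` collects the pieces into `‖p‖² ≤ const · ‖p(T)‖² · exp(const · R)`.

For `C ≥ C₀` this exponential is dominated by the one in `C_state²`, whose prefactor is at least
`C²δ⁴`; this is where `δ` enters `c`.

Testing with the solution needs the identity `d/dt ‖y‖² = 2⟨∂ₜy, y⟩` in `W(V)`. It is proved without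
smoothing in time: a function of a time shift `h` has a minimum at `h = 0`, and its derivative there
is the defect in the identity (`norm_sq_sub_norm_sq_interior`). -/

theorem absolutelyContinuousOnInterval_comp_lipschitz {X Y : Type*} [PseudoMetricSpace X]
    [PseudoMetricSpace Y] {f : ℝ → X} {φ : X → Y} {a b : ℝ} {K : NNReal} {s : Set X}
    (hf : AbsolutelyContinuousOnInterval f a b) (hφ : LipschitzOnWith K φ s)
    (hs : MapsTo f (uIcc a b) s) :
    AbsolutelyContinuousOnInterval (fun x => φ (f x)) a b := by
  rw [absolutelyContinuousOnInterval_iff] at hf ⊢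
  intro ε hε
  obtain ⟨δ, hδ, h⟩ := hf (ε / (K + 1)) (by positivity)
  refine ⟨δ, hδ, fun E hE hlt => ?_⟩
  have h1 := h E hE hlt
  calc ∑ i ∈ Finset.range E.1, dist (φ (f (E.2 i).1)) (φ (f (E.2 i).2))
      ≤ ∑ i ∈ Finset.range E.1, K * dist (f (E.2 i).1) (f (E.2 i).2) :=
        Finset.sum_le_sum fun i hi =>
          hφ.dist_le_mul _ (hs (hE.1 i hi).1) _ (hs (hE.1 i hi).2)
    _ = K * ∑ i ∈ Finset.range E.1, dist (f (E.2 i).1) (f (E.2 i).2) := by rw [Finset.mul_sum]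
    _ ≤ K * (ε / (K + 1)) := by gcongr
    _ < (K + 1) * (ε / (K + 1)) := by gcongr; linarith
    _ = ε := by field

/-- Lets the derivative be given by a formula valid almost everywhere, as happens for products and
powers of primitives of merely integrable functions. -/
theorem integral_eq_sub_of_absolutelyContinuous {F g : ℝ → ℝ} {a b : ℝ}
    (hF : AbsolutelyContinuousOnInterval F a b)
    (h : ∀ᵐ x, x ∈ uIcc a b → HasDerivAt F (g x) x) : ∫ x in a..b, g x = F b - F a := by
  rw [← hF.integral_deriv_eq_sub]
  refine intervalIntegral.integral_congr_ae ?_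
  filter_upwards [h] with x hx hm
  exact (hx (uIoc_subset_uIcc hm)).deriv.symm

theorem absolutelyContinuous_primitive {g : ℝ → ℝ} {a b d : ℝ} (c : ℝ)
    (hg : IntervalIntegrable g volume a b) (hd : d ∈ uIcc a b) :
    AbsolutelyContinuousOnInterval (fun x => c + ∫ t in d..x, g t) a b ∧
      ∀ᵐ x, x ∈ uIcc a b → HasDerivAt (fun x => c + ∫ t in d..x, g t) (g x) x := by
  constructor
  · have h1 : AbsolutelyContinuousOnInterval (fun _ : ℝ => c) a b :=
      (contDiff_const.contDiffOn (n := 1)).absolutelyContinuousOnInterval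
    exact h1.fun_add (hg.absolutelyContinuousOnInterval_intervalIntegral hd)
  · filter_upwards [hg.ae_hasDerivAt_integral] with x hx hm
    exact (hx hm d hd).const_add c

/-- Gronwall's inequality, backwards in time, with an integrable coefficient. -/
theorem gronwall_backward {N β : ℝ → ℝ} {A T : ℝ} (hT : 0 ≤ T)
    (hN : ContinuousOn N (Icc 0 T)) (hβ : IntervalIntegrable β volume 0 T)
    (hβ0 : ∀ t, 0 ≤ β t)
    (h : ∀ t ∈ Icc 0 T, N t ≤ A + ∫ r in t..T, β r * N r) :
    ∀ t ∈ Icc 0 T, N t ≤ A * Real.exp (∫ r in t..T, β r) := by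
  have hu : uIcc 0 T = Icc 0 T := uIcc_of_le hT
  have hβN : IntervalIntegrable (fun r => β r * N r) volume 0 T :=
    hβ.mul_continuousOn (hu ▸ hN)
  obtain ⟨a1, d1⟩ := absolutelyContinuous_primitive A hβN.neg (d := T) (by simp)
  simp only [Pi.neg_apply] at a1 d1
  obtain ⟨a2, d2⟩ := absolutelyContinuous_primitive (0 : ℝ) hβ (d := T) (by simp)
  have a3 : AbsolutelyContinuousOnInterval
      (fun x => Real.exp (0 + ∫ r in T..x, β r)) 0 T := by
    -- The exponent is `-∫ r in x..T, β r ≤ 0`, and `exp` is 1-Lipschitz on the nonpositive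
    -- half-line.
    refine absolutelyContinuousOnInterval_comp_lipschitz (φ := Real.exp) (K := 1)
      (s := Iic 0) a2 ?_ ?_
    · refine Convex.lipschitzOnWith_of_nnnorm_deriv_le (fun x _ => Real.differentiableAt_exp)
        (fun x hx => ?_) (convex_Iic 0)
      rw [Real.deriv_exp, ← NNReal.coe_le_coe]
      simpa [abs_of_pos (Real.exp_pos x)] using hx
    · intro x hx
      rw [hu] at hx
      simp only [mem_Iic, zero_add]
      rw [intervalIntegral.integral_symm]
      exact neg_nonpos.2 (intervalIntegral.integral_nonneg hx.2 fun r _ => hβ0 r)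
  have a4 := a1.fun_mul a3
  intro t ht
  have htT : uIcc t T ⊆ uIcc 0 T := by
    rw [hu, uIcc_of_le ht.2]; exact Icc_subset_Icc_left ht.1
  -- The product `(A + ∫_x^T βN) · exp(-∫_x^T β)` has derivative `β · exp(-∫_x^T β) · (A + ∫_x^T βN
  -- - N) ≥ 0` and equals `A` at `x = T`.
  have key := integral_eq_sub_of_absolutelyContinuous (a4.mono htT)
    (g := fun x => (-(β x * N x)) * Real.exp (0 + ∫ r in T..x, β r) +
      (A + ∫ r in T..x, -(β r * N r)) * (Real.exp (0 + ∫ r in T..x, β r) * β x)) (by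
    filter_upwards [d1, d2] with x h1 h2 hx
    exact (h1 (htT hx)).mul ((h2 (htT hx)).exp))
  have hnn : 0 ≤ ∫ x in t..T, ((-(β x * N x)) * Real.exp (0 + ∫ r in T..x, β r) +
      (A + ∫ r in T..x, -(β r * N r)) * (Real.exp (0 + ∫ r in T..x, β r) * β x)) := by
    refine intervalIntegral.integral_nonneg ht.2 fun x hx => ?_
    have h1 := h x ⟨ht.1.trans hx.1, hx.2⟩
    have h2 : ∫ r in T..x, -(β r * N r) = ∫ r in x..T, β r * N r := by
      rw [intervalIntegral.integral_neg, intervalIntegral.integral_symm, neg_neg]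
    rw [h2]
    have h3 := mul_nonneg (mul_nonneg (hβ0 x) (Real.exp_pos (0 + ∫ r in T..x, β r)).le)
      (sub_nonneg.2 h1)
    linarith
  rw [key] at hnn
  simp only [intervalIntegral.integral_same, add_zero, zero_add, Real.exp_zero, mul_one,
    intervalIntegral.integral_neg] at hnn
  have e1 : ∫ r in T..t, β r = -∫ r in t..T, β r := intervalIntegral.integral_symm _ _
  have e2 : ∫ r in T..t, β r * N r = -∫ r in t..T, β r * N r := intervalIntegral.integral_symm _ _
  rw [e1, e2, neg_neg, Real.exp_neg] at hnn
  have hp := Real.exp_pos (∫ r in t..T, β r)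
  have h5 : (A + ∫ r in t..T, β r * N r) ≤ A * Real.exp (∫ r in t..T, β r) := by
    rw [← div_le_iff₀ hp, div_eq_mul_inv]; linarith
  exact (h t ht).trans h5

/-! ## Weak derivatives on an interval -/

theorem HasWeakDerivOn.mono {Ω Ω' : Set ℝ} {f g : ℝ → ℝ} (h : HasWeakDerivOn Ω f g)
    (hs : Ω' ⊆ Ω) : HasWeakDerivOn Ω' f g := by
  intro φ h1 h2 h3
  have aux : ∀ (k ψ : ℝ → ℝ), tsupport ψ ⊆ Ω' →
      ∫ x in Ω', k x * ψ x = ∫ x in Ω, k x * ψ x := by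
    intro k ψ hψ
    have : ∀ s : Set ℝ, Ω' ⊆ s → ∫ x in s, k x * ψ x = ∫ x, k x * ψ x := fun s hs' =>
      setIntegral_eq_integral_of_forall_compl_eq_zero fun x hx => by
        rw [image_eq_zero_of_notMem_tsupport fun h' => hx (hs' (hψ h')), mul_zero]
    rw [this _ subset_rfl, this _ hs]
  rw [aux _ _ ((tsupport_deriv_subset).trans h3), aux _ _ h3]
  exact h φ h1 h2 (h3.trans hs)

theorem exists_Icc_of_tsupport_subset_Ioo {φ : ℝ → ℝ} {a b : ℝ} (hab : a < b)
    (hc : HasCompactSupport φ) (hs : tsupport φ ⊆ Ioo a b) :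
    ∃ a' b' : ℝ, a < a' ∧ a' ≤ b' ∧ b' < b ∧ tsupport φ ⊆ Icc a' b' := by
  rcases (tsupport φ).eq_empty_or_nonempty with he | hne
  · exact ⟨(a + b) / 2, (a + b) / 2, by linarith, le_rfl, by linarith, by simp [he]⟩
  · have hcpt : IsCompact (tsupport φ) := hc
    refine ⟨sInf (tsupport φ), sSup (tsupport φ), (hs (hcpt.sInf_mem hne)).1, ?_,
      (hs (hcpt.sSup_mem hne)).2, ?_⟩
    · exact csInf_le_csSup hne hcpt.bddBelow hcpt.bddAbove
    · exact fun x hx => ⟨csInf_le hcpt.bddBelow hx, le_csSup hcpt.bddAbove hx⟩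

/-- Integration by parts of a primitive against a test function. -/
theorem hasWeakDerivOn_primitive {g : ℝ → ℝ} {a b : ℝ} (hab : a ≤ b)
    (hg : IntervalIntegrable g volume a b) :
    HasWeakDerivOn (Ioo a b) (fun x => ∫ t in a..x, g t) g := by
  intro φ h1 h2 h3
  have hb : φ b = 0 := image_eq_zero_of_notMem_tsupport fun h => lt_irrefl _ (h3 h).2
  have ha : φ a = 0 := image_eq_zero_of_notMem_tsupport fun h => lt_irrefl _ (h3 h).1
  obtain ⟨a1, d1⟩ := absolutelyContinuous_primitive (0 : ℝ) hg (d := a) (by simp)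
  simp only [zero_add] at a1 d1
  have a2 : AbsolutelyContinuousOnInterval φ a b :=
    ((h1.of_le (by simp)).contDiffOn (n := 1)).absolutelyContinuousOnInterval
  have key := a1.integral_mul_deriv_eq_deriv_mul a2
  rw [hb, ha] at key
  have e : ∫ x in a..b, deriv (fun x => ∫ t in a..x, g t) x * φ x = ∫ x in a..b, g x * φ x := by
    refine intervalIntegral.integral_congr_ae ?_
    filter_upwards [d1] with x hx hm
    rw [(hx (uIoc_subset_uIcc hm)).deriv]
  simp only [e, intervalIntegral.integral_of_le hab (f := fun x => g x * φ x),
    intervalIntegral.integral_of_le hab (f := fun x => (∫ t in a..x, g t) * deriv φ x),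
    integral_Ioc_eq_integral_Ioo, mul_zero, sub_zero, zero_sub] at key
  exact key

/-- The zero mean makes the primitive vanish again to the right of the support of `η`. -/
theorem exists_test_primitive {η : ℝ → ℝ} {a b : ℝ} (hab : a < b) (hη : ContDiff ℝ ∞ η)
    (hc : HasCompactSupport η) (hs : tsupport η ⊆ Ioo a b) (h0 : ∫ x, η x = 0) :
    ∃ Θ : ℝ → ℝ, ContDiff ℝ ∞ Θ ∧ HasCompactSupport Θ ∧ tsupport Θ ⊆ Ioo a b ∧ deriv Θ = η := by
  obtain ⟨a', b', h1, h2, h3, h4⟩ := exists_Icc_of_tsupport_subset_Ioo hab hc hs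
  have hz : ∀ x, x ∉ Icc a' b' → η x = 0 := fun x hx =>
    image_eq_zero_of_notMem_tsupport fun h => hx (h4 h)
  have hd : ∀ x, HasDerivAt (fun x => ∫ t in a'..x, η t) (η x) x := fun x =>
    intervalIntegral.integral_hasDerivAt_right (hη.continuous.intervalIntegrable _ _)
      (hη.continuous.stronglyMeasurableAtFilter _ _) hη.continuous.continuousAt
  have hde : deriv (fun x => ∫ t in a'..x, η t) = η := funext fun x => (hd x).deriv
  have hsupp : Function.support (fun x => ∫ t in a'..x, η t) ⊆ Icc a' b' := by
    intro x hx
    by_contra hn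
    apply hx
    rw [mem_Icc, not_and_or, not_le, not_le] at hn
    rcases hn with hn | hn
    · show ∫ t in a'..x, η t = 0
      -- Here the half-open interval contains `a'`, where `η` is not known to vanish; a single point
      -- is negligible.
      refine intervalIntegral.integral_zero_ae ?_
      filter_upwards [Measure.ae_ne volume a']
        with t ht hm
      rw [uIoc_of_ge hn.le] at hm
      exact hz t fun h => ht (le_antisymm hm.2 h.1)
    · show ∫ t in a'..x, η t = 0
      rw [intervalIntegral.integral_of_le (h2.trans hn.le), ← integral_Icc_eq_integral_Ioc,
        setIntegral_eq_integral_of_forall_compl_eq_zero, h0]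
      intro t ht
      exact hz t fun h => ht ⟨h.1, h.2.trans hn.le⟩
  have htsupp : tsupport (fun x => ∫ t in a'..x, η t) ⊆ Icc a' b' :=
    closure_minimal hsupp isClosed_Icc
  refine ⟨fun x => ∫ t in a'..x, η t, ?_, ?_, ?_, hde⟩
  · rw [contDiff_infty_iff_deriv, hde]
    exact ⟨fun x => (hd x).differentiableAt, hη⟩
  · exact isCompact_Icc.of_isClosed_subset (isClosed_tsupport _) htsupp
  · exact htsupp.trans fun x hx => ⟨h1.trans_le hx.1, hx.2.trans_lt h3⟩

theorem exists_test_integral_eq_one {a b : ℝ} (hab : a < b) :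
    ∃ ψ : ℝ → ℝ, ContDiff ℝ ∞ ψ ∧ HasCompactSupport ψ ∧ tsupport ψ ⊆ Ioo a b ∧
      ∫ x, ψ x = 1 := by
  obtain ⟨f, h1, h2, h3, h4, h5⟩ := exists_contDiff_tsupport_subset (n := ⊤)
    (Ioo_mem_nhds (show a < (a + b) / 2 by linarith) (show (a + b) / 2 < b by linarith))
  have hpos : 0 < ∫ x, f x :=
    h3.continuous.integral_pos_of_hasCompactSupport_nonneg_nonzero h2
      (fun x => (h4 (mem_range_self x)).1) (x := (a + b) / 2) (by rw [h5]; exact one_ne_zero)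
  refine ⟨fun x => (∫ x, f x)⁻¹ * f x, contDiff_const.mul h3, h2.mul_left, ?_, ?_⟩
  · exact (tsupport_mul_subset_right).trans h1
  · rw [integral_const_mul, inv_mul_cancel₀ hpos.ne']

/-- A function with an integrable weak derivative is almost everywhere a primitive of it. -/
theorem HasWeakDerivOn.exists_ae_eq_primitive {f g : ℝ → ℝ} {a b : ℝ} (hab : a < b)
    (hf : IntegrableOn f (Ioo a b)) (hg : IntegrableOn g (Ioo a b))
    (h : HasWeakDerivOn (Ioo a b) f g) :
    ∃ c : ℝ, ∀ᵐ x ∂(volume.restrict (Ioo a b)), f x = c + ∫ t in a..x, g t := by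
  have hgi : IntervalIntegrable g volume a b := by
    rw [intervalIntegrable_iff_integrableOn_Ioo_of_le hab.le]; exact hg
  set G : ℝ → ℝ := fun x => ∫ t in a..x, g t with hG
  have hGw := hasWeakDerivOn_primitive hab.le hgi
  have hGc : ContinuousOn G (Icc a b) := by
    have := intervalIntegral.continuousOn_primitive_interval' (b₁ := a) (b₂ := b) (a := a) hgi
      (by simp)
    rwa [uIcc_of_le hab.le] at this
  have hGi : IntegrableOn G (Ioo a b) :=
    (hGc.integrableOn_Icc).mono_set Ioo_subset_Icc_self
  obtain ⟨ψ, p1, p2, p3, p4⟩ := exists_test_integral_eq_one hab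
  have hbd : ∀ (k φ : ℝ → ℝ), IntegrableOn k (Ioo a b) → Continuous φ → HasCompactSupport φ →
      IntegrableOn (fun x => k x * φ x) (Ioo a b) := by
    intro k φ hk hφ hc
    obtain ⟨C, hC⟩ := hφ.bounded_above_of_compact_support hc
    exact hk.mul_bdd hφ.aestronglyMeasurable (Eventually.of_forall hC)
  -- If `f - G` is constant, its average against `ψ`, which has integral one, is that constant.
  refine ⟨∫ x in Ioo a b, (f x - G x) * ψ x, ?_⟩
  set c := ∫ x in Ioo a b, (f x - G x) * ψ x with hc
  have hfG : IntegrableOn (fun x => f x - G x) (Ioo a b) := hf.sub hGi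
  have hz := isOpen_Ioo.ae_eq_zero_of_integral_contDiff_smul_eq_zero (μ := volume)
    (f := fun x => f x - G x - c) (U := Ioo a b)
    ((hfG.sub (integrableOn_const (by simp))).locallyIntegrableOn) (by
    intro φ f1 f2 f3
    set m := ∫ x, φ x with hm
    -- Du Bois-Reymond: removing the mean of `φ` with a multiple of `ψ` leaves the derivative of a
    -- test function, against which `f - G` integrates to zero.
    have hη : ContDiff ℝ ∞ (fun x => φ x - m * ψ x) := f1.sub (contDiff_const.mul p1)
    have hηc : HasCompactSupport (fun x => φ x - m * ψ x) := f2.sub p2.mul_left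
    have hηs : tsupport (fun x => φ x - m * ψ x) ⊆ Ioo a b :=
      (tsupport_sub φ (fun x => m * ψ x)).trans
        (union_subset f3 ((tsupport_mul_subset_right).trans p3))
    have hφi : Integrable φ := f1.continuous.integrable_of_hasCompactSupport f2
    have hψi : Integrable ψ := p1.continuous.integrable_of_hasCompactSupport p2
    have hη0 : ∫ x, (φ x - m * ψ x) = 0 := by
      rw [integral_sub hφi (hψi.const_mul m), integral_const_mul, p4, ← hm]; ring
    obtain ⟨Θ, t1, t2, t3, t4⟩ := exists_test_primitive hab hη hηc hηs hη0
    have e1 := h Θ t1 t2 t3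
    have e2 := hGw Θ t1 t2 t3
    rw [t4] at e1 e2
    have e3 : ∫ x in Ioo a b, (f x - G x) * (φ x - m * ψ x) = 0 := by
      simp only [sub_mul (f _)]
      rw [integral_sub (hbd _ _ hf hη.continuous hηc) (hbd _ _ hGi hη.continuous hηc), e1, e2,
        sub_self]
    have e4 : ∫ x in Ioo a b, (f x - G x) * φ x = m * c := by
      have : ∫ x in Ioo a b, (f x - G x) * (φ x - m * ψ x)
          = ∫ x in Ioo a b, ((f x - G x) * φ x - m * ((f x - G x) * ψ x)) := by
        congr 1; ext x; ring
      rw [this, integral_sub (hbd _ _ hfG f1.continuous f2)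
        ((hbd _ _ hfG p1.continuous p2).const_mul m), integral_const_mul] at e3
      linarith
    have hφz : ∀ x, x ∉ Ioo a b → φ x = 0 := fun x hx =>
      image_eq_zero_of_notMem_tsupport fun h' => hx (f3 h')
    have e5 : ∫ x in Ioo a b, φ x = m :=
      setIntegral_eq_integral_of_forall_compl_eq_zero hφz
    rw [← setIntegral_eq_integral_of_forall_compl_eq_zero (s := Ioo a b)
      (fun x hx => by rw [hφz x hx, zero_smul])]
    have e6 : ∫ x in Ioo a b, φ x • (f x - G x - c)
        = ∫ x in Ioo a b, ((f x - G x) * φ x - c * φ x) := by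
      congr 1; ext x; simp only [smul_eq_mul]; ring
    rw [e6, integral_sub (hbd _ _ hfG f1.continuous f2) (hφi.integrableOn.const_mul c), e4,
      integral_const_mul, e5]
    ring)
  rw [ae_restrict_iff' measurableSet_Ioo]
  filter_upwards [hz] with x hx hm
  linarith [hx hm]

/-! ## Functions in `H¹(ℝ)` -/

theorem Lp_norm_sq_eq_integral {α E : Type*} [MeasurableSpace α] [NormedAddCommGroup E]
    {μ : Measure α} (f : Lp E 2 μ) : ‖f‖ ^ 2 = ∫ x, ‖f x‖ ^ 2 ∂μ := by
  have h := (Lp.memLp f).eLpNorm_eq_integral_rpow_norm (by simp) (by simp)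
  have h2 : ∀ x, ‖f x‖ ^ (ENNReal.toReal 2) = ‖f x‖ ^ 2 := fun x => by
    rw [ENNReal.toReal_ofNat, Real.rpow_ofNat]
  simp only [h2] at h
  have hnn : 0 ≤ ∫ x, ‖f x‖ ^ 2 ∂μ := integral_nonneg fun x => by positivity
  rw [Lp.norm_def, h, ENNReal.toReal_ofReal (by positivity), ENNReal.toReal_ofNat,
    ← Real.rpow_natCast, ← Real.rpow_mul hnn]
  norm_num

theorem hasWeakDerivOn_toL2 {Ω : Set ℝ} (φ : H1 Ω) :
    HasWeakDerivOn Ω (toL2 φ) (weakDeriv φ) :=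
  (show H1Submodule Ω from φ).2

theorem H1_norm_sq {Ω : Set ℝ} (φ : H1 Ω) : ‖φ‖ ^ 2 = ‖toL2 φ‖ ^ 2 + ‖weakDeriv φ‖ ^ 2 :=
  WithLp.prod_norm_sq_eq_of_L2 (show H1Submodule Ω from φ).1

theorem norm_weakDeriv_le {Ω : Set ℝ} (φ : H1 Ω) : ‖weakDeriv φ‖ ≤ ‖φ‖ :=
  (sq_le_sq₀ (norm_nonneg _) (norm_nonneg _)).1
    (by rw [H1_norm_sq]; nlinarith [sq_nonneg ‖toL2 φ‖])

theorem memLp_H (f : H) : MemLp f 2 volume := by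
  simpa using Lp.memLp f

theorem integrable_H_sq (f : H) : Integrable (fun x => f x ^ 2) :=
  (memLp_H f).integrable_sq

theorem integrable_H_mul (f g : H) : Integrable (fun x => f x * g x) :=
  (memLp_H f).integrable_mul (memLp_H g)

theorem locallyIntegrable_H (f : H) : LocallyIntegrable f volume :=
  (memLp_H f).locallyIntegrable (by norm_num)

theorem intervalIntegrable_H (f : H) (a b : ℝ) : IntervalIntegrable f volume a b :=
  ((locallyIntegrable_H f).integrableOn_isCompact isCompact_uIcc).intervalIntegrable

theorem H_norm_sq (f : H) : ‖f‖ ^ 2 = ∫ x, f x ^ 2 := by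
  rw [Lp_norm_sq_eq_integral]; simp

/-- The continuous representative of a function in `H¹(ℝ)`. -/
theorem exists_ae_eq_primitive (φ : V) :
    ∃ c : ℝ, ∀ᵐ x : ℝ, toL2 φ x = c + ∫ t in (0 : ℝ)..x, weakDeriv φ t := by
  have hii := intervalIntegrable_H (weakDeriv φ)
  -- The line is exhausted by bounded intervals, on which the derivative is integrable; `n + 1`
  -- keeps the one for `n = 0` nondegenerate.
  have h1 : ∀ n : ℕ, ∃ c : ℝ, ∀ᵐ x ∂(volume.restrict (Ioo (-(n + 1 : ℝ)) (n + 1))),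
      toL2 φ x = c + ∫ t in (0 : ℝ)..x, weakDeriv φ t := by
    intro n
    have hn : -(n + 1 : ℝ) < n + 1 := by linarith [n.cast_nonneg (α := ℝ)]
    obtain ⟨c, hc⟩ := ((hasWeakDerivOn_toL2 φ).mono (subset_univ _)).exists_ae_eq_primitive hn
      (((intervalIntegrable_iff_integrableOn_Ioo_of_le hn.le).1 (intervalIntegrable_H _ _ _)))
      (((intervalIntegrable_iff_integrableOn_Ioo_of_le hn.le).1 (hii _ _)))
    refine ⟨c + ∫ t in (-(n + 1 : ℝ))..0, weakDeriv φ t, ?_⟩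
    filter_upwards [hc] with x hx
    rw [hx, add_assoc, intervalIntegral.integral_add_adjacent_intervals (hii _ _) (hii _ _)]
  choose c hc using h1
  -- All the intervals contain `(-1, 1)`, a set of positive measure, so the constants agree.
  have h2 : ∀ n, c n = c 0 := by
    intro n
    have hs : Ioo (-1 : ℝ) 1 ⊆ Ioo (-(n + 1 : ℝ)) (n + 1) := by
      apply Ioo_subset_Ioo <;> linarith [n.cast_nonneg (α := ℝ)]
    have h3 := ae_restrict_of_ae_restrict_of_subset hs (hc n)
    have h4 := hc 0
    simp only [Nat.cast_zero, zero_add] at h4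
    have h5 : ∀ᵐ x ∂(volume.restrict (Ioo (-1 : ℝ) 1)), c n = c 0 := by
      filter_upwards [h3, h4] with x e1 e2
      linarith
    have : (ae (volume.restrict (Ioo (-1 : ℝ) 1))).NeBot := by
      rw [ae_restrict_neBot]; simp
    exact h5.exists.choose_spec
  refine ⟨c 0, ?_⟩
  have h6 : ∀ᵐ x : ℝ, ∀ n : ℕ, x ∈ Ioo (-(n + 1 : ℝ)) (n + 1) →
      toL2 φ x = c n + ∫ t in (0 : ℝ)..x, weakDeriv φ t := by
    rw [ae_all_iff]
    exact fun n => (ae_restrict_iff' measurableSet_Ioo).1 (hc n)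
  filter_upwards [h6] with x hx
  obtain ⟨n, hn⟩ := exists_nat_gt |x|
  have := hx n ⟨by linarith [neg_abs_le x], by linarith [le_abs_self x]⟩
  rw [this, h2]

/-- The square yields the sup bound on `H¹(ℝ)`, the cube the cancellation of the convection term. -/
theorem integral_pow_primitive {g : ℝ → ℝ} (hg : ∀ a b, IntervalIntegrable g volume a b)
    (c a b : ℝ) :
    let F := fun x => c + ∫ t in (0 : ℝ)..x, g t
    (∫ x in a..b, 2 * F x * g x = F b ^ 2 - F a ^ 2) ∧
      ∫ x in a..b, 3 * F x ^ 2 * g x = F b ^ 3 - F a ^ 3 := by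
  intro F
  have hFeq : F = fun x => F a + ∫ t in a..x, g t := by
    ext x
    simp only [F]
    rw [add_assoc, intervalIntegral.integral_add_adjacent_intervals (hg _ _) (hg _ _)]
  obtain ⟨h1, h2⟩ := absolutelyContinuous_primitive (F a) (hg a b) (d := a) (by simp)
  rw [← hFeq] at h1 h2
  constructor
  · have := integral_eq_sub_of_absolutelyContinuous (h1.fun_mul h1)
      (g := fun x => 2 * F x * g x) (by
        filter_upwards [h2] with x hx hm
        exact ((hx hm).mul (hx hm)).congr_deriv (by ring))
    rw [this]; ring
  · have := integral_eq_sub_of_absolutelyContinuous ((h1.fun_mul h1).fun_mul h1)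
      (g := fun x => 3 * F x ^ 2 * g x) (by
        filter_upwards [h2] with x hx hm
        exact (((hx hm).mul (hx hm)).mul (hx hm)).congr_deriv (by
          simp only [Pi.mul_apply]; ring))
    rw [this]; ring

/-- The square of a primitive `F` of `g` is bounded by integrals over an adjacent unit interval. -/
theorem sq_primitive_le {g : ℝ → ℝ} (hg : ∀ a b, IntervalIntegrable g volume a b)
    (hg2 : ∀ a b, IntervalIntegrable (fun x => g x ^ 2) volume a b) (c x : ℝ) :
    let F := fun x => c + ∫ t in (0 : ℝ)..x, g t
    F x ^ 2 ≤ 2 * (∫ t in x..(x + 1), F t ^ 2) + ∫ t in x..(x + 1), g t ^ 2 := by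
  intro F
  have hFc : Continuous F :=
    continuous_const.add (intervalIntegral.continuous_primitive hg 0)
  have hF2 : ∀ a b, IntervalIntegrable (fun x => F x ^ 2) volume a b :=
    fun a b => (hFc.pow 2).intervalIntegrable a b
  set K := (∫ t in x..(x + 1), F t ^ 2) + ∫ t in x..(x + 1), g t ^ 2 with hK
  -- From `(F²)' = 2Fg` and `-2Fg ≤ F² + g²`; averaging over `z` in the unit interval then gives the
  -- claim.
  have key : ∀ z ∈ Icc x (x + 1), F x ^ 2 ≤ F z ^ 2 + K := by
    intro z hz
    have e := (integral_pow_primitive hg c x z).1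
    have e' : ∫ t in x..z, 2 * F t * g t = F z ^ 2 - F x ^ 2 := e
    have b1 : -∫ t in x..z, 2 * F t * g t ≤ ∫ t in x..z, (F t ^ 2 + g t ^ 2) := by
      rw [← intervalIntegral.integral_neg]
      refine intervalIntegral.integral_mono_on hz.1 ?_ ((hF2 _ _).add (hg2 _ _)) ?_
      · exact ((hg x z).continuousOn_mul (continuous_const.mul hFc).continuousOn).neg
      · intro t _
        nlinarith [sq_nonneg (F t + g t)]
    have b2 : ∫ t in x..z, (F t ^ 2 + g t ^ 2) ≤ K := by
      rw [hK, ← intervalIntegral.integral_add (hF2 _ _) (hg2 _ _)]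
      refine intervalIntegral.integral_mono_interval le_rfl hz.1 hz.2 ?_
        ((hF2 _ _).add (hg2 _ _))
      exact Eventually.of_forall fun t => by simp only [Pi.zero_apply]; positivity
    linarith
  have h := intervalIntegral.integral_mono_on (f := fun _ => F x ^ 2) (g := fun z => F z ^ 2 + K)
    (μ := volume) (a := x) (b := x + 1) (by linarith) (by simp) ((hF2 _ _).add (by simp)) key
  rw [intervalIntegral.integral_add (hF2 _ _) (by simp)] at h
  simp only [intervalIntegral.integral_const, add_sub_cancel_left, one_smul] at h
  linarith

/-- The Sobolev embedding of `H¹(ℝ)` into the bounded functions. -/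
theorem ae_sq_le_norm_sq (φ : V) : ∀ᵐ x : ℝ, toL2 φ x ^ 2 ≤ 2 * ‖φ‖ ^ 2 := by
  obtain ⟨c, hc⟩ := exists_ae_eq_primitive φ
  filter_upwards [hc] with x hx
  have h := sq_primitive_le (intervalIntegrable_H (weakDeriv φ))
    (fun a b => (integrable_H_sq (weakDeriv φ)).intervalIntegrable) c x
  simp only [← hx] at h
  have e1 : ∫ t in x..(x + 1), (c + ∫ s in (0 : ℝ)..t, weakDeriv φ s) ^ 2
      = ∫ t in x..(x + 1), toL2 φ t ^ 2 := by
    refine intervalIntegral.integral_congr_ae ?_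
    filter_upwards [hc] with t ht _
    rw [ht]
  have e2 : ∀ f : H, ∫ t in x..(x + 1), f t ^ 2 ≤ ‖f‖ ^ 2 := by
    intro f
    rw [H_norm_sq, intervalIntegral.integral_of_le (by linarith)]
    exact setIntegral_le_integral (integrable_H_sq f) (Eventually.of_forall fun t => sq_nonneg _)
  rw [e1] at h
  have h1 := e2 (toL2 φ)
  have h2 := e2 (weakDeriv φ)
  have h3 := H1_norm_sq φ
  nlinarith [sq_nonneg ‖weakDeriv φ‖]

theorem ae_abs_le_norm (φ : V) : ∀ᵐ x : ℝ, |toL2 φ x| ≤ 2 * ‖φ‖ := by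
  filter_upwards [ae_sq_le_norm_sq φ] with x hx
  refine abs_le_of_sq_le_sq (hx.trans ?_) (by positivity)
  nlinarith [sq_nonneg ‖φ‖]

theorem integrable_triple (φ : V) (f g : H) :
    Integrable (fun x => toL2 φ x * (f x * g x)) :=
  (integrable_H_mul f g).bdd_mul (memLp_H (toL2 φ)).1
    ((ae_abs_le_norm φ).mono fun x hx => by simpa using hx)

/-- Combined with `sq_primitive_le`, this makes functions in `H¹(ℝ)` vanish at infinity. -/
theorem tendsto_unit_interval_integral {k : ℝ → ℝ} (hk : Integrable k) {l : Filter ℝ}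
    (hl : l = atTop ∨ l = atBot) :
    Tendsto (fun x => ∫ t in x..(x + 1), k t) l (𝓝 0) := by
  have e : (fun x => ∫ t in x..(x + 1), k t)
      = fun x => (∫ t in (0 : ℝ)..(x + 1), k t) - ∫ t in (0 : ℝ)..x, k t := by
    ext x
    rw [intervalIntegral.integral_interval_sub_left hk.intervalIntegrable hk.intervalIntegrable]
  rw [e]
  rcases hl with rfl | rfl
  · have h := intervalIntegral_tendsto_integral_Ioi 0 hk.integrableOn tendsto_id
    simpa using (h.comp (tendsto_atTop_add_const_right atTop (1 : ℝ) tendsto_id)).sub h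
  · have h := (intervalIntegral_tendsto_integral_Iic 0 hk.integrableOn tendsto_id).neg
    simp only [← intervalIntegral.integral_symm] at h
    simpa using (h.comp (tendsto_atBot_add_const_right atBot (1 : ℝ) tendsto_id)).sub h

/-- The convection term vanishes in the energy balance of the Burgers equation. -/
theorem integral_convection_self (φ : V) :
    ∫ x, toL2 φ x * weakDeriv φ x * toL2 φ x = 0 := by
  obtain ⟨c, hc⟩ := exists_ae_eq_primitive φ
  set F : ℝ → ℝ := fun x => c + ∫ t in (0 : ℝ)..x, weakDeriv φ t with hF
  have hg := intervalIntegrable_H (weakDeriv φ)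
  have hg2 := integrable_H_sq (weakDeriv φ)
  have hF2 : Integrable (fun x => F x ^ 2) :=
    (integrable_H_sq (toL2 φ)).congr (hc.mono fun x hx => by simp only [hx, hF])
  have hI : Integrable (fun x => 3 * F x ^ 2 * weakDeriv φ x) := by
    refine ((integrable_triple φ (toL2 φ) (weakDeriv φ)).const_mul 3).congr ?_
    filter_upwards [hc] with x hx
    simp only [hx, hF]; ring
  have h0 : ∀ l : Filter ℝ, (l = atTop ∨ l = atBot) → Tendsto F l (𝓝 0) := by
    intro l hl
    have h1 : Tendsto (fun x => F x ^ 2) l (𝓝 0) := by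
      refine squeeze_zero (fun x => sq_nonneg _)
        (fun x => sq_primitive_le hg (fun a b => hg2.intervalIntegrable) c x) ?_
      simpa using ((tendsto_unit_interval_integral hF2 hl).const_mul 2).add
        (tendsto_unit_interval_integral hg2 hl)
    have h2 := (Real.continuous_sqrt.tendsto 0).comp h1
    simp only [Real.sqrt_zero, Function.comp_def, Real.sqrt_sq_eq_abs] at h2
    exact (tendsto_zero_iff_abs_tendsto_zero F).2 h2
  -- The integrand is `(F³)'`, so its integral over `(-n, n)` is a boundary term that tends to zero.
  have hlim := intervalIntegral_tendsto_integral hI tendsto_neg_atTop_atBot tendsto_id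
  have hlim2 : Tendsto (fun n : ℝ => F n ^ 3 - F (-n) ^ 3) atTop (𝓝 0) := by
    simpa using ((h0 atTop (Or.inl rfl)).pow 3).sub
      (((h0 atBot (Or.inr rfl)).comp tendsto_neg_atTop_atBot).pow 3)
  have e : (fun n : ℝ => ∫ x in (-n)..(id n), 3 * F x ^ 2 * weakDeriv φ x)
      = fun n : ℝ => F n ^ 3 - F (-n) ^ 3 :=
    funext fun n => (integral_pow_primitive hg c (-n) n).2
  rw [e] at hlim
  have h3 := tendsto_nhds_unique hlim hlim2
  have h4 : ∫ x, toL2 φ x * weakDeriv φ x * toL2 φ x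
      = ∫ x, (1 / 3 : ℝ) * (3 * F x ^ 2 * weakDeriv φ x) := by
    refine integral_congr_ae ?_
    filter_upwards [hc] with x hx
    simp only [hx, hF]; ring
  rw [h4, integral_const_mul, h3, mul_zero]

/-- `|∫ y f g| ≤ ‖y‖_∞ ‖f‖ ‖g‖` for `y` in `H¹(ℝ)`. -/
theorem abs_integral_triple_le (φ : V) (f g : H) :
    |∫ x, toL2 φ x * (f x * g x)| ≤ 2 * ‖φ‖ * (‖f‖ * ‖g‖) := by
  have h1 : |∫ x, toL2 φ x * (f x * g x)| ≤ ∫ x, 2 * ‖φ‖ * (|f x| * |g x|) := by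
    refine (abs_integral_le_integral_abs).trans (integral_mono_ae
      (integrable_triple φ f g).abs ?_ ?_)
    · refine ((integrable_H_mul f g).abs.congr ?_).const_mul _
      exact Eventually.of_forall fun x => abs_mul _ _
    · filter_upwards [ae_abs_le_norm φ] with x hx
      simp only [abs_mul]
      gcongr
  have h2 : ∫ x, |f x| * |g x| ≤ ‖f‖ * ‖g‖ := by
    have hh := real_inner_le_norm |f| |g|
    rw [norm_abs_eq_norm, norm_abs_eq_norm, L2.inner_def] at hh
    refine le_trans (le_of_eq ?_) hh
    simp only [setIntegral_univ]
    refine integral_congr_ae ?_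
    filter_upwards [(ae_restrict_iff' MeasurableSet.univ).1 (Lp.coeFn_abs f),
      (ae_restrict_iff' MeasurableSet.univ).1 (Lp.coeFn_abs g)] with x e1 e2
    simp [e1 trivial, e2 trivial, mul_comm]
  rw [integral_const_mul] at h1
  exact h1.trans (by gcongr)

/-! ## The pairing of a translated function in `L²(ℝ; E*)` with a function in `L²(ℝ; E)` -/

section Pairing

variable {E : Type*} [NormedAddCommGroup E] [NormedSpace ℝ E]

theorem integrable_pairing {α : Type*} [MeasurableSpace α] {μ : Measure α}
    {a : α → StrongDual ℝ E} {b : α → E} (ha : MemLp a 2 μ) (hb : MemLp b 2 μ) :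
    Integrable (fun t => a t (b t)) μ :=
  memLp_one_iff_integrable.1
    ((ContinuousLinearMap.id ℝ (StrongDual ℝ E)).memLp_of_bilin 1 ha hb)

/-- Translation is continuous in `L²`, and pairing with a fixed `b` is a bounded linear functional.
-/
theorem continuous_translate_pairing {a : ℝ → StrongDual ℝ E} {b : ℝ → E}
    (ha : MemLp a 2 volume) (hb : MemLp b 2 volume) :
    Continuous (fun σ : ℝ => ∫ t, a (t + σ) (b t)) := by
  let G : ℝ → C(ℝ, ℝ) := fun σ => ⟨fun t => t + σ, by fun_prop⟩
  have hG : Continuous G :=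
    ContinuousMap.continuous_of_continuous_uncurry _
      (show Continuous fun p : ℝ × ℝ => p.2 + p.1 by fun_prop)
  have hmp : ∀ σ, MeasurePreserving (G σ) volume volume := fun σ =>
    measurePreserving_add_right volume σ
  have hc : Continuous fun σ => Lp.compMeasurePreserving (G σ) (hmp σ) ha.toLp :=
    Continuous.compMeasurePreservingLp (continuous_const (y := ha.toLp)) hG hmp (by simp)
  have e : (fun σ : ℝ => ∫ t, a (t + σ) (b t)) = fun σ =>
      (ContinuousLinearMap.id ℝ (StrongDual ℝ E)).lpPairing volume 2 2
        (Lp.compMeasurePreserving (G σ) (hmp σ) ha.toLp) hb.toLp := by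
    ext σ
    rw [ContinuousLinearMap.lpPairing_eq_integral]
    refine integral_congr_ae ?_
    filter_upwards [Lp.coeFn_compMeasurePreserving ha.toLp (hmp σ), hb.coeFn_toLp,
      (hmp σ).quasiMeasurePreserving.ae ha.coeFn_toLp] with t h1 h2 h3
    rw [h1, h2, Function.comp_apply, h3]
    rfl
  rw [e]
  exact ((((ContinuousLinearMap.id ℝ (StrongDual ℝ E)).lpPairing volume 2 2).flip
    hb.toLp).continuous).comp hc

/-- Prepares Fubini: the integrand is dominated by `‖a(t+σ)‖² + ‖b(t)‖²`, integrable because `σ`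
ranges over a bounded interval. Strong measurability of `a` gives joint measurability of the
translate. -/
theorem integrable_prod_translate_pairing {a : ℝ → StrongDual ℝ E} {b : ℝ → E}
    (hs : StronglyMeasurable a) (ha : MemLp a 2 volume) (hb : MemLp b 2 volume) (h : ℝ) :
    Integrable (fun p : ℝ × ℝ => a (p.1 + p.2) (b p.1))
      (volume.prod (volume.restrict (uIoc 0 h))) := by
  have : IsFiniteMeasure (volume.restrict (uIoc 0 h)) := ⟨by simp [uIoc]⟩
  have h1 : Integrable (fun p : ℝ × ℝ => ‖b p.1‖ ^ 2)
      (volume.prod (volume.restrict (uIoc 0 h))) :=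
    ((memLp_two_iff_integrable_sq_norm hb.1).1 hb).comp_fst _
  have hm : StronglyMeasurable fun p : ℝ × ℝ => a (p.1 + p.2) :=
    hs.comp_measurable (by fun_prop)
  have ha2 := (memLp_two_iff_integrable_sq_norm ha.1).1 ha
  have h2 : Integrable (fun p : ℝ × ℝ => ‖a (p.1 + p.2)‖ ^ 2)
      (volume.prod (volume.restrict (uIoc 0 h))) := by
    have hm2 : StronglyMeasurable fun p : ℝ × ℝ => ‖a (p.1 + p.2)‖ ^ 2 := hm.norm.pow 2
    rw [integrable_prod_iff' hm2.aestronglyMeasurable]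
    constructor
    · exact Eventually.of_forall fun σ => ha2.comp_add_right σ
    · have : (fun σ : ℝ => ∫ t, ‖‖a (t + σ)‖ ^ 2‖) = fun _ => ∫ t, ‖‖a t‖ ^ 2‖ :=
        funext fun σ => integral_add_right_eq_self (fun t => ‖‖a t‖ ^ 2‖) σ
      simp only [this]
      exact integrable_const _
  refine (h1.add h2).mono' ?_ (Eventually.of_forall fun p => ?_)
  · exact (ContinuousLinearMap.id ℝ (StrongDual ℝ E)).aestronglyMeasurable_comp₂
      hm.aestronglyMeasurable hb.1.comp_fst
  · refine ((a (p.1 + p.2)).le_opNorm (b p.1)).trans ?_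
    simp only [Pi.add_apply]
    nlinarith [sq_nonneg (‖a (p.1 + p.2)‖ - ‖b p.1‖), sq_nonneg (‖a (p.1 + p.2)‖ + ‖b p.1‖)]

theorem integral_translate_pairing_swap {a : ℝ → StrongDual ℝ E} {b : ℝ → E}
    (hs : StronglyMeasurable a) (ha : MemLp a 2 volume) (hb : MemLp b 2 volume) (h : ℝ) :
    Integrable (fun t => ∫ σ in (0 : ℝ)..h, a (t + σ) (b t)) ∧
    ∫ t, ∫ σ in (0 : ℝ)..h, a (t + σ) (b t) = ∫ σ in (0 : ℝ)..h, ∫ t, a (t + σ) (b t) := by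
  have hi := integrable_prod_translate_pairing hs ha hb h
  simp only [intervalIntegral.intervalIntegral_eq_integral_uIoc]
  constructor
  · exact hi.integral_prod_left.smul (if (0 : ℝ) ≤ h then (1 : ℝ) else -1)
  · rw [integral_smul, integral_integral_swap hi]

end Pairing

/-! ### The energy identity at interior times, by a shift argument -/

theorem memLp_indicator_of_restrict {F : Type*} [NormedAddCommGroup F] {f : ℝ → F} {s : Set ℝ}
    (hs : MeasurableSet s) (hf : MemLp f 2 (volume.restrict s)) :
    MemLp (s.indicator f) 2 volume :=
  (memLp_indicator_iff_restrict hs).2 hf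

/-- The energy identity between two interior times. -/
theorem norm_sq_sub_norm_sq_interior {E K : Type*} [NormedAddCommGroup E] [NormedSpace ℝ E]
    [NormedAddCommGroup K] [InnerProductSpace ℝ K] {J : E → K} {T : ℝ} (hT : 0 < T)
    {g : ℝ → StrongDual ℝ E} {w : ℝ → E} (hgs : StronglyMeasurable g)
    (hg : MemLp g 2 (timeMeasure T)) (hw : MemLp w 2 (timeMeasure T)) {Y : ℝ → K}
    (hY : ContinuousOn Y (Icc 0 T)) (hYy : Y =ᵐ[timeMeasure T] fun s => J (w s))
    (hinc : ∀ v : E, ∀ s ∈ Icc 0 T, ∀ t ∈ Icc 0 T, ⟪Y t - Y s, J v⟫ = ∫ r in s..t, g r v)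
    {s τ : ℝ} (hs : 0 < s) (hsτ : s ≤ τ) (hτ : τ < T) :
    ‖Y τ‖ ^ 2 - ‖Y s‖ ^ 2 = 2 * ∫ r in s..τ, g r (w r) := by
  -- Cutting off turns shifts in time into translations of `L²` functions on the whole line. For
  -- small `h`, `(s, τ] + h` stays inside `(0, T)`, so the cutoff of `g` is not felt.
  set a : ℝ → StrongDual ℝ E := (Ioo 0 T).indicator g with ha
  set b : ℝ → E := (Ioc s τ).indicator w with hb
  have hst : Ioc s τ ⊆ Ioo 0 T := fun x hx => ⟨hs.trans hx.1, hx.2.trans_lt hτ⟩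
  have has : StronglyMeasurable a :=
    hgs.indicator measurableSet_Ioo
  have haL : MemLp a 2 volume := memLp_indicator_of_restrict measurableSet_Ioo hg
  have hwst : MemLp w 2 (volume.restrict (Ioc s τ)) :=
    hw.mono_measure (Measure.restrict_mono_set volume hst)
  have hbL : MemLp b 2 volume := memLp_indicator_of_restrict measurableSet_Ioc hwst
  set D : ℝ → ℝ := fun σ => ∫ t, a (t + σ) (b t) with hD
  have hDc : Continuous D := continuous_translate_pairing haL hbL
  -- The projection extends `‖Y‖²` continuously to the line.
  set N : ℝ → ℝ := fun r => ‖Y (projIcc 0 T hT.le r)‖ ^ 2 with hN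
  have hNc : Continuous N :=
    ((hY.comp_continuous (continuous_subtype_val.comp continuous_projIcc)
      fun r => (projIcc 0 T hT.le r).2).norm).pow 2
  have hNY : ∀ r ∈ Icc 0 T, N r = ‖Y r‖ ^ 2 := fun r hr => by
    simp only [hN, projIcc_of_mem hT.le hr]
  have hD0 : D 0 = ∫ r in s..τ, g r (w r) := by
    have h1 : ∀ t, a (t + 0) (b t) = (Ioc s τ).indicator (fun r => g r (w r)) t := by
      intro t
      by_cases ht : t ∈ Ioc s τ
      · simp [ha, hb, ht, hst ht]
      · simp [hb, ht]
    simp only [hD, h1]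
    rw [intervalIntegral.integral_of_le hsτ, integral_indicator measurableSet_Ioc]
  -- Its derivative at `0` is `N τ - N s - 2 D 0`, the defect in the energy identity.
  set e : ℝ → ℝ := fun h => (∫ t in s..τ, N (t + h)) - 2 * ∫ σ in (0 : ℝ)..h, D σ with he
  have hP : ∀ x, HasDerivAt (fun x => ∫ t in (0 : ℝ)..x, N t) (N x) x := fun x =>
    hNc.integral_hasStrictDerivAt 0 x |>.hasDerivAt
  have hder : HasDerivAt e (N τ - N s - 2 * D 0) 0 := by
    have h1 : HasDerivAt (fun h => ∫ t in s..τ, N (t + h)) (N τ - N s) 0 := by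
      have e1 : (fun h => ∫ t in s..τ, N (t + h))
          = fun h => (∫ t in (0 : ℝ)..(τ + h), N t) - ∫ t in (0 : ℝ)..(s + h), N t := by
        ext h
        rw [intervalIntegral.integral_comp_add_right, intervalIntegral.integral_interval_sub_left
          (hNc.intervalIntegrable _ _) (hNc.intervalIntegrable _ _)]
      rw [e1]
      have t1 : HasDerivAt (fun h : ℝ => ∫ t in (0 : ℝ)..(τ + h), N t) (N τ) 0 :=
        HasDerivAt.comp_const_add τ 0 (by simpa using hP τ)
      have t2 : HasDerivAt (fun h : ℝ => ∫ t in (0 : ℝ)..(s + h), N t) (N s) 0 :=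
        HasDerivAt.comp_const_add s 0 (by simpa using hP s)
      exact t1.sub t2
    exact h1.sub ((hDc.integral_hasStrictDerivAt 0 0).hasDerivAt.const_mul 2)
  -- Convexity of the squared norm gives `‖Y(t+h)‖² - ‖Y(t)‖² ≥ 2⟪Y(t+h) - Y(t), Y(t)⟫` for either
  -- sign of `h`, and the right side is an integral of `g` paired with the fixed vector `w t`.
  -- Integrating over `t` gives `e h ≥ e 0`.
  have hmin : IsLocalMin e 0 := by
    have hnb : ∀ᶠ h : ℝ in 𝓝 0, h ∈ Ioo (-s) (T - τ) :=
      Ioo_mem_nhds (by linarith) (by linarith)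
    filter_upwards [hnb] with h hh
    have hNh : Continuous fun t => N (t + h) := hNc.comp (continuous_add_const h)
    obtain ⟨hsi, hsw⟩ := integral_translate_pairing_swap has haL hbL h
    have hmem : ∀ t ∈ Ioc s τ, t + h ∈ Ioo 0 T := fun t ht =>
      ⟨by linarith [ht.1, hh.1], by linarith [ht.2, hh.2]⟩
    have hpt : ∀ᵐ t ∂(volume.restrict (Ioc s τ)),
        2 * ∫ σ in (0 : ℝ)..h, a (t + σ) (b t) ≤ N (t + h) - N t := by
      filter_upwards [ae_restrict_of_ae_restrict_of_subset hst hYy,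
        ae_restrict_mem measurableSet_Ioc] with t hYt ht
      have m1 := Ioo_subset_Icc_self (hst ht)
      have m2 := Ioo_subset_Icc_self (hmem t ht)
      have hint : ∫ σ in (0 : ℝ)..h, a (t + σ) (b t)
          = ∫ r in t..(t + h), g r (w t) := by
        rw [intervalIntegral.integral_comp_add_left (fun r => a r (b t)), add_zero]
        apply intervalIntegral.integral_congr
        intro r hr
        have hr' : r ∈ Ioo 0 T := ordConnected_Ioo.uIcc_subset (hst ht) (hmem t ht) hr
        simp [ha, hb, ht, hr']
      rw [hint, ← hinc _ _ m1 _ m2, ← hYt, hNY _ m1, hNY _ m2]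
      have hsq : ‖Y (t + h)‖ ^ 2 = ‖Y (t + h) - Y t‖ ^ 2 + 2 * ⟪Y (t + h) - Y t, Y t⟫
          + ‖Y t‖ ^ 2 := by
        rw [← norm_add_sq_real, sub_add_cancel]
      nlinarith [sq_nonneg ‖Y (t + h) - Y t‖]
    have hle : 2 * ∫ σ in (0 : ℝ)..h, D σ ≤ ∫ t in s..τ, (N (t + h) - N t) := by
      have hz : ∀ t, t ∉ Ioc s τ → ∫ σ in (0 : ℝ)..h, a (t + σ) (b t) = 0 := fun t ht => by
        simp [hb, ht]
      simp only [hD]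
      rw [← hsw, ← setIntegral_eq_integral_of_forall_compl_eq_zero hz, ← integral_const_mul,
        intervalIntegral.integral_of_le hsτ]
      have i1 : IntegrableOn (fun t => 2 * ∫ σ in (0 : ℝ)..h, a (t + σ) (b t)) (Ioc s τ) :=
        hsi.integrableOn.const_mul 2
      have i2 : IntegrableOn (fun t => N (t + h) - N t) (Ioc s τ) :=
        (intervalIntegrable_iff_integrableOn_Ioc_of_le hsτ).1
          ((hNh.sub hNc).intervalIntegrable _ _)
      exact setIntegral_mono_ae_restrict i1 i2 hpt
    rw [intervalIntegral.integral_sub (hNh.intervalIntegrable _ _)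
      (hNc.intervalIntegrable _ _)] at hle
    simp only [he, add_zero, intervalIntegral.integral_same, mul_zero, sub_zero]
    linarith
  have h0 := hmin.hasDerivAt_eq_zero hder
  rw [hNY _ ⟨(hs.trans_le hsτ).le, hτ.le⟩, hNY _ ⟨hs.le, (hsτ.trans hτ.le)⟩, hD0] at h0
  linarith

/-! ## The energy identity in `W(V)` -/

theorem memLp_two_integrable {E : Type*} [NormedAddCommGroup E] {T : ℝ} {f : ℝ → E}
    (hf : MemLp f 2 (timeMeasure T)) : Integrable f (timeMeasure T) :=
  hf.integrable (by norm_num)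

theorem intervalIntegrable_of_timeMeasure {E : Type*} [NormedAddCommGroup E] {T : ℝ} {f : ℝ → E}
    (hf : Integrable f (timeMeasure T)) {s t : ℝ} (hs : s ∈ Icc 0 T) (ht : t ∈ Icc 0 T) :
    IntervalIntegrable f volume s t := by
  have h0 : (0 : ℝ) ≤ T := hs.1.trans hs.2
  have : IntervalIntegrable f volume 0 T :=
    (intervalIntegrable_iff_integrableOn_Ioo_of_le h0).2 hf
  refine this.mono_set ?_
  rw [uIcc_of_le h0]
  exact uIcc_subset_Icc hs ht

theorem integrable_timeDeriv_val {T : ℝ} (y : W T) :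
    Integrable (fun t => timeDeriv y t (val y t)) (timeMeasure T) :=
  integrable_pairing (Lp.memLp _) (Lp.memLp _)

/-- Both sides come from continuous functions of time that agree almost everywhere, hence everywhere
on `[0, T]`, endpoints included. -/
theorem inner_sub_eq_integral_timeDeriv {T : ℝ} (hT : 0 < T) (y : W T) {Y : ℝ → H}
    (hY : ContinuousOn Y (Icc 0 T)) (hYy : Y =ᵐ[timeMeasure T] fun s => toL2 (val y s)) (v : V)
    {s t : ℝ} (hs : s ∈ Icc 0 T) (ht : t ∈ Icc 0 T) :
    ⟪Y t - Y s, toL2 v⟫ = ∫ r in s..t, timeDeriv y r v := by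
  have hw : HasWeakDerivOn (Ioo 0 T) (fun t => ⟪toL2 (val y t), toL2 v⟫)
      (fun t => timeDeriv y t v) := (show WSubmodule T from y).2 v
  have hgi : Integrable (fun t => timeDeriv y t v) (timeMeasure T) :=
    memLp_two_integrable (memLp_apply _ v)
  obtain ⟨c, hc⟩ := hw.exists_ae_eq_primitive hT
    (memLp_two_integrable (memLp_inner_toL2 _ v)) hgi
  have hii : ∀ {s t : ℝ}, s ∈ Icc 0 T → t ∈ Icc 0 T →
      IntervalIntegrable (fun t => timeDeriv y t v) volume s t :=
    fun h1 h2 => intervalIntegrable_of_timeMeasure hgi h1 h2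
  have h0 : (0 : ℝ) ∈ Icc 0 T := left_mem_Icc.2 hT.le
  have heq : EqOn (fun t => ⟪Y t, toL2 v⟫) (fun t => c + ∫ r in (0 : ℝ)..t, timeDeriv y r v)
      (Icc 0 T) := by
    refine Measure.eqOn_Icc_of_ae_eq volume hT.ne ?_ (hY.inner continuousOn_const) ?_
    · rw [← restrict_Ioo_eq_restrict_Icc]
      filter_upwards [hYy, hc] with t e1 e2
      rw [e1]
      exact e2
    · have := intervalIntegral.continuousOn_primitive_interval' (a := 0)
        (hii h0 (right_mem_Icc.2 hT.le)) (by simp)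
      rw [uIcc_of_le hT.le] at this
      exact continuousOn_const.add this
  have e1 := heq hs
  have e2 := heq ht
  simp only at e1 e2
  rw [inner_sub_left, e1, e2, add_sub_add_left_eq_sub,
    intervalIntegral.integral_interval_sub_left (hii h0 ht) (hii h0 hs)]

/-- The energy identity for functions in `W(V)`. -/
theorem norm_sq_sub_norm_sq {T : ℝ} (hT : 0 < T) (y : W T) {Y : ℝ → H}
    (hY : ContinuousOn Y (Icc 0 T)) (hYy : Y =ᵐ[timeMeasure T] fun s => toL2 (val y s))
    {s τ : ℝ} (hs : s ∈ Icc 0 T) (hτ : τ ∈ Icc 0 T) :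
    ‖Y τ‖ ^ 2 - ‖Y s‖ ^ 2 = 2 * ∫ r in s..τ, timeDeriv y r (val y r) := by
  have hii : ∀ {s t : ℝ}, s ∈ Icc 0 T → t ∈ Icc 0 T →
      IntervalIntegrable (fun r => timeDeriv y r (val y r)) volume s t :=
    fun h1 h2 => intervalIntegrable_of_timeMeasure (integrable_timeDeriv_val y) h1 h2
  have h0 : (0 : ℝ) ∈ Icc 0 T := left_mem_Icc.2 hT.le
  have hm : T / 2 ∈ Ioo 0 T := ⟨by linarith, by linarith⟩
  -- The interior identity makes `Q` constant on `(0, T)`; continuity carries this to the endpoints,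
  -- where there is no room to shift.
  set Q : ℝ → ℝ := fun r => ‖Y r‖ ^ 2 - 2 * ∫ r in (0 : ℝ)..r, timeDeriv y r (val y r) with hQ
  have hQc : ContinuousOn Q (Icc 0 T) := by
    have := intervalIntegral.continuousOn_primitive_interval' (a := 0)
      (hii h0 (right_mem_Icc.2 hT.le)) (by simp)
    rw [uIcc_of_le hT.le] at this
    exact (hY.norm.pow 2).sub (continuousOn_const.mul this)
  have hsub : ∀ {s τ : ℝ}, s ∈ Icc 0 T → τ ∈ Icc 0 T →
      Q τ - Q s = ‖Y τ‖ ^ 2 - ‖Y s‖ ^ 2 - 2 * ∫ r in s..τ, timeDeriv y r (val y r) := by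
    intro s τ hs hτ
    rw [← intervalIntegral.integral_interval_sub_left (hii h0 hτ) (hii h0 hs)]
    simp only [hQ]; ring
  have hin : ∀ {s τ : ℝ}, 0 < s → s ≤ τ → τ < T →
      ‖Y τ‖ ^ 2 - ‖Y s‖ ^ 2 = 2 * ∫ r in s..τ, timeDeriv y r (val y r) :=
    fun h1 h2 h3 => norm_sq_sub_norm_sq_interior hT (Lp.stronglyMeasurable _) (Lp.memLp _)
      (Lp.memLp _) hY hYy (fun v _ hs _ ht => inner_sub_eq_integral_timeDeriv hT y hY hYy v hs ht)
      h1 h2 h3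
  have hint : EqOn Q (fun _ => Q (T / 2)) (Ioo 0 T) := by
    intro r hr
    have hr' := Ioo_subset_Icc_self hr
    have hm' := Ioo_subset_Icc_self hm
    rcases le_total r (T / 2) with h | h
    · have := hin hr.1 h hm.2
      have := hsub hr' hm'
      simp only; linarith
    · have := hin hm.1 h hr.2
      have := hsub hm' hr'
      simp only; linarith
  have hcl : EqOn Q (fun _ => Q (T / 2)) (Icc 0 T) :=
    hint.of_subset_closure hQc continuousOn_const Ioo_subset_Icc_self
      (closure_Ioo hT.ne).symm.subset
  have := hsub hs hτ
  rw [hcl hs, hcl hτ, sub_self] at this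
  linarith

/-! ## Energy estimates -/

theorem integral_mono_of_timeMeasure {T : ℝ} {f g : ℝ → ℝ} (hf : Integrable f (timeMeasure T))
    (hg : Integrable g (timeMeasure T)) (h : ∀ᵐ r ∂(timeMeasure T), f r ≤ g r) {s t : ℝ}
    (hs : s ∈ Icc 0 T) (ht : t ∈ Icc 0 T) (hst : s ≤ t) :
    ∫ r in s..t, f r ≤ ∫ r in s..t, g r := by
  refine intervalIntegral.integral_mono_ae_restrict hst
    (intervalIntegrable_of_timeMeasure hf hs ht) (intervalIntegrable_of_timeMeasure hg hs ht) ?_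
  rw [timeMeasure, restrict_Ioo_eq_restrict_Icc] at h
  exact ae_restrict_of_ae_restrict_of_subset (Icc_subset_Icc hs.1 ht.2) h

theorem integral_mono_interval_of_timeMeasure {T : ℝ} {f : ℝ → ℝ}
    (hf : Integrable f (timeMeasure T)) (h : ∀ r, 0 ≤ f r) {t : ℝ} (ht : t ∈ Icc 0 T) :
    (∫ r in (0 : ℝ)..t, f r ≤ ∫ r in (0 : ℝ)..T, f r) ∧
      ∫ r in t..T, f r ≤ ∫ r in (0 : ℝ)..T, f r := by
  have h0 : (0 : ℝ) ∈ Icc 0 T := left_mem_Icc.2 (ht.1.trans ht.2)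
  have hT : T ∈ Icc 0 T := right_mem_Icc.2 (ht.1.trans ht.2)
  have hi := intervalIntegrable_of_timeMeasure hf h0 hT
  have hnn : 0 ≤ᵐ[volume.restrict (Ioc 0 T)] f := Eventually.of_forall h
  exact ⟨intervalIntegral.integral_mono_interval le_rfl ht.1 ht.2 hnn hi,
    intervalIntegral.integral_mono_interval ht.1 ht.2 le_rfl hnn hi⟩

theorem integral_timeMeasure {T : ℝ} (hT : 0 ≤ T) (f : ℝ → ℝ) :
    ∫ r, f r ∂(timeMeasure T) = ∫ r in (0 : ℝ)..T, f r := by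
  rw [intervalIntegral.integral_of_le hT, integral_Ioc_eq_integral_Ioo]

theorem integrable_norm_sq_Lp {E : Type*} [NormedAddCommGroup E] {T : ℝ}
    (f : Lp E 2 (timeMeasure T)) : Integrable (fun r => ‖f r‖ ^ 2) (timeMeasure T) :=
  (memLp_two_iff_integrable_sq_norm (Lp.memLp f).1).1 (Lp.memLp f)

theorem integrable_norm_sq_val {T : ℝ} (y : W T) :
    Integrable (fun r => ‖val y r‖ ^ 2) (timeMeasure T) :=
  integrable_norm_sq_Lp _

theorem integrable_norm_sq_weakDeriv_val {T : ℝ} (y : W T) :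
    Integrable (fun r => ‖weakDeriv (val y r)‖ ^ 2) (timeMeasure T) := by
  have h : MemLp (fun r => weakDeriv (val y r)) 2 (timeMeasure T) :=
    (weakDeriv (Ω := univ)).comp_memLp' (Lp.memLp _)
  exact (memLp_two_iff_integrable_sq_norm h.1).1 h

theorem integral_norm_sq_val_le {T : ℝ} (hT : 0 < T) (y : W T) {Y : ℝ → H} {R : ℝ}
    (hYy : Y =ᵐ[timeMeasure T] fun s => toL2 (val y s)) (hR : ∀ t ∈ Icc 0 T, ‖Y t‖ ^ 2 ≤ R) :
    ∫ r in (0 : ℝ)..T, ‖val y r‖ ^ 2 ≤ T * R + ∫ r in (0 : ℝ)..T, ‖weakDeriv (val y r)‖ ^ 2 := by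
  have h0 : (0 : ℝ) ∈ Icc 0 T := left_mem_Icc.2 hT.le
  have hTT : T ∈ Icc 0 T := right_mem_Icc.2 hT.le
  have hw := integrable_norm_sq_weakDeriv_val y
  have h := integral_mono_of_timeMeasure (integrable_norm_sq_val y)
    ((integrable_const R).add hw) (by
      filter_upwards [hYy, ae_restrict_mem measurableSet_Ioo] with r hr hm
      have := hR r (Ioo_subset_Icc_self hm)
      rw [hr] at this
      simp only [Pi.add_apply, H1_norm_sq]
      linarith) h0 hTT hT.le
  simp only [Pi.add_apply] at h
  rw [intervalIntegral.integral_add (by simp) (intervalIntegrable_of_timeMeasure hw h0 hTT)] at h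
  simpa using h

/-- Cauchy–Schwarz, with `κ` the `L²` norm of `χ`. -/
theorem exists_pairing_bound {χ : ℝ → ℝ} (hχ : Continuous χ) (hχc : HasCompactSupport χ) :
    ∃ κ : ℝ, 0 ≤ κ ∧ ∀ f : H, |∫ x, χ x * f x| ≤ κ * ‖f‖ := by
  have hm : MemLp χ 2 (volume.restrict univ) := hχ.memLp_of_hasCompactSupport hχc
  refine ⟨‖hm.toLp‖, norm_nonneg _, fun f => ?_⟩
  have h := abs_real_inner_le_norm (hm.toLp : H) f
  rw [L2.inner_def] at h
  simp only [setIntegral_univ] at h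
  convert! h using 2
  refine integral_congr_ae ?_
  filter_upwards [(ae_restrict_iff' MeasurableSet.univ).1 hm.coeFn_toLp] with x hx
  simp [hx trivial, mul_comm]

/-- The energy estimate for the state equation. -/
theorem state_energy_estimate {ν T κ : ℝ} (hν : 0 < ν) (hT : 0 < T) {χ : ℝ → ℝ}
    (hκ : 0 ≤ κ) (hχ : ∀ f : H, |∫ x, χ x * f x| ≤ κ * ‖f‖) {u : H1 (Ioo 0 T)} {y : W T}
    {Y : ℝ → H} (hY : ContinuousOn Y (Icc 0 T))
    (hYy : Y =ᵐ[timeMeasure T] fun s => toL2 (val y s))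
    (heq : ∀ᵐ t ∂(timeMeasure T), ∀ φ : V,
      timeDeriv y t φ + (∫ x, toL2 (val y t) x * weakDeriv (val y t) x * toL2 φ x)
        + ν * ⟪weakDeriv (val y t), weakDeriv φ⟫ = toL2 u t * ∫ x, χ x * toL2 φ x) :
    (∀ t ∈ Icc 0 T, ‖Y t‖ ^ 2 ≤ 2 * ‖Y 0‖ ^ 2 + 4 * T * κ ^ 2 * ‖toL2 u‖ ^ 2) ∧
      2 * ν * ∫ r in (0 : ℝ)..T, ‖weakDeriv (val y r)‖ ^ 2
        ≤ 2 * ‖Y 0‖ ^ 2 + 4 * T * κ ^ 2 * ‖toL2 u‖ ^ 2 := by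
  have h0 : (0 : ℝ) ∈ Icc 0 T := left_mem_Icc.2 hT.le
  have hTT : T ∈ Icc 0 T := right_mem_Icc.2 hT.le
  have hw := integrable_norm_sq_weakDeriv_val y
  have hu : Integrable (fun r => ‖toL2 u r‖ ^ 2) (timeMeasure T) := integrable_norm_sq_Lp _
  -- Absorbing the maximum of `‖Y‖` replaces Gronwall and keeps the state bound quadratic in the
  -- data, so that only one exponential appears later.
  obtain ⟨t₀, ht₀, hmax⟩ := isCompact_Icc.exists_isMaxOn ⟨0, h0⟩ hY.norm
  set m := ‖Y t₀‖ with hm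
  have key : ∀ t ∈ Icc 0 T, ‖Y t‖ ^ 2 + 2 * ν * ∫ r in (0 : ℝ)..t, ‖weakDeriv (val y r)‖ ^ 2
      ≤ ‖Y 0‖ ^ 2 + m ^ 2 / 2 + 2 * T * κ ^ 2 * ‖toL2 u‖ ^ 2 := by
    intro t ht
    have hid := norm_sq_sub_norm_sq hT y hY hYy h0 ht
    have hpt : ∀ᵐ r ∂(timeMeasure T), timeDeriv y r (val y r) ≤
        (m ^ 2 / (4 * T) + T * κ ^ 2 * ‖toL2 u r‖ ^ 2) - ν * ‖weakDeriv (val y r)‖ ^ 2 := by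
      filter_upwards [heq, hYy, ae_restrict_mem measurableSet_Ioo] with r hr hyr hmem
      have e := hr (val y r)
      rw [integral_convection_self, real_inner_self_eq_norm_sq] at e
      have b1 : ‖toL2 (val y r)‖ ≤ m := by
        rw [← hyr]; exact hmax (Ioo_subset_Icc_self hmem)
      have b2 : toL2 u r * ∫ x, χ x * toL2 (val y r) x ≤ ‖toL2 u r‖ * (κ * m) := by
        refine (le_abs_self _).trans ?_
        rw [abs_mul, ← Real.norm_eq_abs (toL2 u r)]
        exact mul_le_mul_of_nonneg_left ((hχ _).trans (by gcongr)) (norm_nonneg _)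
      -- The Young weight is chosen so that doubling and integrating over `[0, T]` produces `m² /
      -- 2`, half of what is to be bounded.
      have b3 : ‖toL2 u r‖ * (κ * m) ≤ m ^ 2 / (4 * T) + T * κ ^ 2 * ‖toL2 u r‖ ^ 2 := by
        have : m ^ 2 / (4 * T) + T * κ ^ 2 * ‖toL2 u r‖ ^ 2 - ‖toL2 u r‖ * (κ * m)
            = (m - 2 * T * κ * ‖toL2 u r‖) ^ 2 / (4 * T) := by field
        have h2 : 0 ≤ (m - 2 * T * κ * ‖toL2 u r‖) ^ 2 / (4 * T) := by positivity
        linarith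
      linarith
    have i1 : Integrable (fun r => m ^ 2 / (4 * T) + T * κ ^ 2 * ‖toL2 u r‖ ^ 2)
        (timeMeasure T) := (integrable_const _).add (hu.const_mul _)
    have hle := integral_mono_of_timeMeasure (integrable_timeDeriv_val y)
      (i1.sub (hw.const_mul ν)) hpt h0 ht ht.1
    simp only [Pi.sub_apply] at hle
    rw [intervalIntegral.integral_sub (intervalIntegrable_of_timeMeasure i1 h0 ht)
      (intervalIntegrable_of_timeMeasure (hw.const_mul ν) h0 ht),
      intervalIntegral.integral_const_mul] at hle
    have b4 : ∫ r in (0 : ℝ)..t, (m ^ 2 / (4 * T) + T * κ ^ 2 * ‖toL2 u r‖ ^ 2)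
        ≤ m ^ 2 / 4 + T * κ ^ 2 * ‖toL2 u‖ ^ 2 := by
      refine (integral_mono_interval_of_timeMeasure i1 (fun r => by positivity) ht).1.trans ?_
      rw [intervalIntegral.integral_add (by simp)
        (intervalIntegrable_of_timeMeasure (hu.const_mul _) h0 hTT),
        intervalIntegral.integral_const_mul,
        ← integral_timeMeasure hT.le (fun r => ‖toL2 u r‖ ^ 2), ← Lp_norm_sq_eq_integral]
      simp only [intervalIntegral.integral_const, sub_zero, smul_eq_mul]
      apply le_of_eq
      field
    linarith
  have hwn : ∀ t ∈ Icc 0 T, 0 ≤ 2 * ν * ∫ r in (0 : ℝ)..t, ‖weakDeriv (val y r)‖ ^ 2 :=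
    fun t ht => mul_nonneg (by positivity)
      (intervalIntegral.integral_nonneg ht.1 fun r _ => by positivity)
  have hm2 : m ^ 2 ≤ 2 * ‖Y 0‖ ^ 2 + 4 * T * κ ^ 2 * ‖toL2 u‖ ^ 2 := by
    have := key t₀ ht₀
    have := hwn t₀ ht₀
    linarith
  constructor
  · intro t ht
    have h1 : ‖Y t‖ ≤ m := hmax ht
    exact (pow_le_pow_left₀ (norm_nonneg _) h1 2).trans hm2
  · have := key T hTT
    nlinarith [sq_nonneg ‖Y T‖]

/-- The energy estimate for the adjoint equation. -/
theorem adjoint_energy_estimate {ν T B : ℝ} (hν : 0 < ν) (hT : 0 < T) {y p : W T}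
    {P : ℝ → H} (hP : ContinuousOn P (Icc 0 T))
    (hPp : P =ᵐ[timeMeasure T] fun s => toL2 (val p s))
    (heq : ∀ᵐ t ∂(timeMeasure T), ∀ φ : V,
      timeDeriv p t φ + (∫ x, toL2 (val y t) x * weakDeriv (val p t) x * toL2 φ x)
        - ν * ⟪weakDeriv (val p t), weakDeriv φ⟫ = 0)
    (hB : 4 / ν * ∫ r in (0 : ℝ)..T, ‖val y r‖ ^ 2 ≤ B) :
    (∀ t ∈ Icc 0 T, ‖P t‖ ^ 2 ≤ ‖P T‖ ^ 2 * Real.exp B) ∧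
      ν * ∫ r in (0 : ℝ)..T, ‖weakDeriv (val p r)‖ ^ 2 ≤ ‖P T‖ ^ 2 * Real.exp (2 * B) := by
  have h0 : (0 : ℝ) ∈ Icc 0 T := left_mem_Icc.2 hT.le
  have hTT : T ∈ Icc 0 T := right_mem_Icc.2 hT.le
  have hw := integrable_norm_sq_weakDeriv_val p
  -- Young's inequality for `4‖y‖_V ‖∂ₓp‖ ‖p‖` spends `ν‖∂ₓp‖²`, half of the dissipation `2ν‖∂ₓp‖²`,
  -- and leaves this coefficient in front of `‖p‖²`.
  set β : ℝ → ℝ := fun r => 4 / ν * ‖val y r‖ ^ 2 with hβ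
  have hβi : Integrable β (timeMeasure T) := (integrable_norm_sq_val y).const_mul _
  have hβ0 : ∀ r, 0 ≤ β r := fun r => by positivity
  have hβB : ∫ r in (0 : ℝ)..T, β r ≤ B := by
    rw [hβ, intervalIntegral.integral_const_mul]; exact hB
  have hN : ContinuousOn (fun t => ‖P t‖ ^ 2) (Icc 0 T) := hP.norm.pow 2
  have hβN : Integrable (fun r => β r * ‖P r‖ ^ 2) (timeMeasure T) := by
    have h1 := (intervalIntegrable_of_timeMeasure hβi h0 hTT).mul_continuousOn
      (g := fun t => ‖P t‖ ^ 2) (by rwa [uIcc_of_le hT.le])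
    exact (intervalIntegrable_iff_integrableOn_Ioo_of_le hT.le).1 h1
  have key : ∀ t ∈ Icc 0 T, ‖P t‖ ^ 2 + ν * ∫ r in t..T, ‖weakDeriv (val p r)‖ ^ 2
      ≤ ‖P T‖ ^ 2 + ∫ r in t..T, β r * ‖P r‖ ^ 2 := by
    intro t ht
    have hid := norm_sq_sub_norm_sq hT p hP hPp ht hTT
    have hpt : ∀ᵐ r ∂(timeMeasure T), ν * ‖weakDeriv (val p r)‖ ^ 2 - β r * ‖P r‖ ^ 2 ≤
        2 * timeDeriv p r (val p r) := by
      filter_upwards [heq, hPp] with r hr hpr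
      have e := hr (val p r)
      rw [real_inner_self_eq_norm_sq] at e
      have b1 := (abs_le.1 (abs_integral_triple_le (val y r) (weakDeriv (val p r))
        (toL2 (val p r)))).2
      simp only [← mul_assoc] at b1
      rw [hpr]
      have b2 : 2 * (2 * ‖val y r‖ * ‖weakDeriv (val p r)‖ * ‖toL2 (val p r)‖)
          ≤ ν * ‖weakDeriv (val p r)‖ ^ 2 + β r * ‖toL2 (val p r)‖ ^ 2 := by
        have : ν * ‖weakDeriv (val p r)‖ ^ 2 + β r * ‖toL2 (val p r)‖ ^ 2
            - 2 * (2 * ‖val y r‖ * ‖weakDeriv (val p r)‖ * ‖toL2 (val p r)‖)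
            = (ν * ‖weakDeriv (val p r)‖ - 2 * ‖val y r‖ * ‖toL2 (val p r)‖) ^ 2 / ν := by
          simp only [hβ]; field
        have h2 : 0 ≤ (ν * ‖weakDeriv (val p r)‖ - 2 * ‖val y r‖ * ‖toL2 (val p r)‖) ^ 2 / ν := by
          positivity
        linarith
      linarith
    have hle := integral_mono_of_timeMeasure ((hw.const_mul ν).sub hβN)
      ((integrable_timeDeriv_val p).const_mul 2) hpt ht hTT ht.2
    simp only [Pi.sub_apply] at hle
    rw [intervalIntegral.integral_sub (intervalIntegrable_of_timeMeasure (hw.const_mul ν) ht hTT)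
      (intervalIntegrable_of_timeMeasure hβN ht hTT), intervalIntegral.integral_const_mul,
      intervalIntegral.integral_const_mul] at hle
    linarith
  have hgr := gronwall_backward (A := ‖P T‖ ^ 2) hT.le hN
    (intervalIntegrable_of_timeMeasure hβi h0 hTT) hβ0 (fun t ht => by
      have h1 : 0 ≤ ν * ∫ r in t..T, ‖weakDeriv (val p r)‖ ^ 2 := mul_nonneg hν.le
        (intervalIntegral.integral_nonneg ht.2 fun r _ => by positivity)
      have := key t ht
      linarith)
  have hfirst : ∀ t ∈ Icc 0 T, ‖P t‖ ^ 2 ≤ ‖P T‖ ^ 2 * Real.exp B := fun t ht =>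
    (hgr t ht).trans (by
      gcongr
      exact (integral_mono_interval_of_timeMeasure hβi hβ0 ht).2.trans hβB)
  refine ⟨hfirst, ?_⟩
  have hB0 : 0 ≤ B :=
    (intervalIntegral.integral_nonneg hT.le fun r _ => hβ0 r).trans hβB
  have hle : ∫ r in (0 : ℝ)..T, β r * ‖P r‖ ^ 2 ≤ B * (‖P T‖ ^ 2 * Real.exp B) := by
    have h1 := integral_mono_of_timeMeasure hβN (hβi.mul_const (‖P T‖ ^ 2 * Real.exp B)) (by
      filter_upwards [ae_restrict_mem measurableSet_Ioo] with r hr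
      exact mul_le_mul_of_nonneg_left (hfirst r (Ioo_subset_Icc_self hr)) (hβ0 r)) h0 hTT hT.le
    rw [intervalIntegral.integral_mul_const] at h1
    exact h1.trans (by gcongr)
  have hk := key 0 h0
  -- The factor `B` from integrating `β` is absorbed by a second exponential.
  have he : 1 + B * Real.exp B ≤ Real.exp (2 * B) := by
    have h1 : B + 1 ≤ Real.exp B := Real.add_one_le_exp B
    have h2 : 1 ≤ Real.exp B := Real.one_le_exp hB0
    rw [two_mul, Real.exp_add]
    nlinarith
  calc ν * ∫ r in (0 : ℝ)..T, ‖weakDeriv (val p r)‖ ^ 2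
      ≤ ‖P T‖ ^ 2 * (1 + B * Real.exp B) := by linarith [sq_nonneg ‖P 0‖]
    _ ≤ ‖P T‖ ^ 2 * Real.exp (2 * B) := by gcongr

/-! ### The norm of the adjoint state in `W(V)` -/

theorem W_norm_sq {T : ℝ} (hT : 0 ≤ T) (p : W T) :
    ‖p‖ ^ 2 = (∫ r in (0 : ℝ)..T, ‖val p r‖ ^ 2) + ∫ r in (0 : ℝ)..T, ‖timeDeriv p r‖ ^ 2 := by
  rw [← integral_timeMeasure hT, ← integral_timeMeasure hT]
  refine (WithLp.prod_norm_sq_eq_of_L2 (show WSubmodule T from p).1).trans ?_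
  rw [Lp_norm_sq_eq_integral, Lp_norm_sq_eq_integral]
  rfl

/-- The dual norm of the time derivative of a solution of the adjoint equation. -/
theorem norm_timeDeriv_sq_le {ν T R : ℝ} (hν : 0 < ν) {y p : W T} {Y : ℝ → H}
    (hYy : Y =ᵐ[timeMeasure T] fun s => toL2 (val y s)) (hR : ∀ t ∈ Icc 0 T, ‖Y t‖ ^ 2 ≤ R)
    (heq : ∀ᵐ t ∂(timeMeasure T), ∀ φ : V,
      timeDeriv p t φ + (∫ x, toL2 (val y t) x * weakDeriv (val p t) x * toL2 φ x)
        - ν * ⟪weakDeriv (val p t), weakDeriv φ⟫ = 0) :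
    ∀ᵐ t ∂(timeMeasure T),
      ‖timeDeriv p t‖ ^ 2 ≤ (8 * R + 2 * ν ^ 2) * ‖weakDeriv (val p t)‖ ^ 2 := by
  filter_upwards [heq, hYy, ae_restrict_mem measurableSet_Ioo] with t ht hyt hm
  have hRt := hR t (Ioo_subset_Icc_self hm)
  rw [hyt] at hRt
  have hop : ‖timeDeriv p t‖
      ≤ 2 * ‖toL2 (val y t)‖ * ‖weakDeriv (val p t)‖ + ν * ‖weakDeriv (val p t)‖ := by
    refine ContinuousLinearMap.opNorm_le_bound _ (by positivity) fun φ => ?_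
    have e := ht φ
    -- The sup bound is put on `φ`, so `y` enters only through its `H` norm, which `R` bounds
    -- uniformly in time.
    have e1 : ∫ x, toL2 (val y t) x * weakDeriv (val p t) x * toL2 φ x
        = ∫ x, toL2 φ x * (toL2 (val y t) x * weakDeriv (val p t) x) := by
      congr 1; ext x; ring
    rw [e1] at e
    have b1 := abs_integral_triple_le φ (toL2 (val y t)) (weakDeriv (val p t))
    have b2 : |⟪weakDeriv (val p t), weakDeriv φ⟫| ≤ ‖weakDeriv (val p t)‖ * ‖φ‖ :=
      (abs_real_inner_le_norm _ _).trans (by gcongr; exact norm_weakDeriv_le φ)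
    have e2 : timeDeriv p t φ = ν * ⟪weakDeriv (val p t), weakDeriv φ⟫
        - ∫ x, toL2 φ x * (toL2 (val y t) x * weakDeriv (val p t) x) := by linarith
    rw [e2, Real.norm_eq_abs]
    refine (abs_sub _ _).trans ?_
    rw [abs_mul, abs_of_pos hν]
    nlinarith [mul_le_mul_of_nonneg_left b2 hν.le]
  calc ‖timeDeriv p t‖ ^ 2
      ≤ (2 * ‖toL2 (val y t)‖ * ‖weakDeriv (val p t)‖ + ν * ‖weakDeriv (val p t)‖) ^ 2 := by gcongr
    _ ≤ (8 * ‖toL2 (val y t)‖ ^ 2 + 2 * ν ^ 2) * ‖weakDeriv (val p t)‖ ^ 2 := by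
        nlinarith [sq_nonneg (2 * ‖toL2 (val y t)‖ * ‖weakDeriv (val p t)‖
          - ν * ‖weakDeriv (val p t)‖)]
    _ ≤ _ := by gcongr

/-- The bound for the adjoint state in `W(V)` in terms of a bound `R` for the state. -/
theorem adjoint_norm_sq_le {ν T R : ℝ} (hν : 0 < ν) (hT : 0 < T) {y p : W T} {Y P : ℝ → H}
    (hYy : Y =ᵐ[timeMeasure T] fun s => toL2 (val y s)) (hR : ∀ t ∈ Icc 0 T, ‖Y t‖ ^ 2 ≤ R)
    (hR' : 2 * ν * ∫ r in (0 : ℝ)..T, ‖weakDeriv (val y r)‖ ^ 2 ≤ R)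
    (hP : ContinuousOn P (Icc 0 T)) (hPp : P =ᵐ[timeMeasure T] fun s => toL2 (val p s))
    (heq : ∀ᵐ t ∂(timeMeasure T), ∀ φ : V,
      timeDeriv p t φ + (∫ x, toL2 (val y t) x * weakDeriv (val p t) x * toL2 φ x)
        - ν * ⟪weakDeriv (val p t), weakDeriv φ⟫ = 0) :
    ‖p‖ ^ 2 ≤ (T + 9 / ν + 2 * ν) * ‖P T‖ ^ 2
      * Real.exp ((1 + 8 / ν * (T + 1 / (2 * ν))) * R) := by
  have h0 : (0 : ℝ) ∈ Icc 0 T := left_mem_Icc.2 hT.le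
  have hTT : T ∈ Icc 0 T := right_mem_Icc.2 hT.le
  have hR0 : 0 ≤ R := (sq_nonneg _).trans (hR 0 h0)
  -- Over `(0, T)` the `H` part of `‖y‖_V²` contributes at most `T R`, the derivative part `R /
  -- (2ν)`.
  set B := 4 / ν * ((T + 1 / (2 * ν)) * R) with hBdef
  have hB0 : 0 ≤ B := by positivity
  have hB : 4 / ν * ∫ r in (0 : ℝ)..T, ‖val y r‖ ^ 2 ≤ B := by
    have h1 := integral_norm_sq_val_le hT y hYy hR
    have h2 : ∫ r in (0 : ℝ)..T, ‖weakDeriv (val y r)‖ ^ 2 ≤ 1 / (2 * ν) * R := by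
      rw [one_div, inv_mul_eq_div, le_div_iff₀ (by positivity)]; linarith
    rw [hBdef]
    gcongr
    linarith
  obtain ⟨h1, h2⟩ := adjoint_energy_estimate hν hT hP hPp heq hB
  set A := ‖P T‖ ^ 2 with hA
  have hA0 : 0 ≤ A := sq_nonneg _
  set d := ∫ r in (0 : ℝ)..T, ‖weakDeriv (val p r)‖ ^ 2 with hd
  have h2' : d ≤ A * Real.exp (2 * B) / ν := by
    rw [le_div_iff₀ hν]; linarith
  have h3 := integral_norm_sq_val_le hT p hPp h1
  have h4 : ∫ r in (0 : ℝ)..T, ‖timeDeriv p r‖ ^ 2 ≤ (8 * R + 2 * ν ^ 2) * d := by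
    rw [hd, ← intervalIntegral.integral_const_mul]
    exact integral_mono_of_timeMeasure (integrable_norm_sq_Lp _)
      ((integrable_norm_sq_weakDeriv_val p).const_mul _) (norm_timeDeriv_sq_le hν hYy hR heq)
      h0 hTT hT.le
  -- The extra `R` in the exponent pays for the linear factor `8 * R` in the bound for `∂ₜp`,
  -- through `R ≤ exp R`.
  have hexp : (1 + 8 / ν * (T + 1 / (2 * ν))) * R = R + 2 * B := by rw [hBdef]; ring
  rw [W_norm_sq hT.le, hexp]
  have g1 : Real.exp B ≤ Real.exp (R + 2 * B) := Real.exp_le_exp.2 (by linarith)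
  have g2 : Real.exp (2 * B) ≤ Real.exp (R + 2 * B) := Real.exp_le_exp.2 (by linarith)
  have g3 : R * Real.exp (2 * B) ≤ Real.exp (R + 2 * B) := by
    rw [Real.exp_add]
    gcongr
    linarith [Real.add_one_le_exp R]
  have g4 : (8 * R + 2 * ν ^ 2) * d ≤ (8 * R + 2 * ν ^ 2) * (A * Real.exp (2 * B) / ν) := by
    gcongr
  have g5 : (8 * R + 2 * ν ^ 2) * (A * Real.exp (2 * B) / ν)
      = 8 / ν * A * (R * Real.exp (2 * B)) + 2 * ν * A * Real.exp (2 * B) := by field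
  have g6 : A * Real.exp (2 * B) / ν = 1 / ν * A * Real.exp (2 * B) := by field
  calc (∫ r in (0 : ℝ)..T, ‖val p r‖ ^ 2) + ∫ r in (0 : ℝ)..T, ‖timeDeriv p r‖ ^ 2
      ≤ T * A * Real.exp B + 1 / ν * A * Real.exp (2 * B)
        + (8 / ν * A * (R * Real.exp (2 * B)) + 2 * ν * A * Real.exp (2 * B)) := by linarith
    _ ≤ T * A * Real.exp (R + 2 * B) + 1 / ν * A * Real.exp (R + 2 * B)
        + (8 / ν * A * Real.exp (R + 2 * B) + 2 * ν * A * Real.exp (R + 2 * B)) := by gcongr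
    _ = (T + 9 / ν + 2 * ν) * A * Real.exp (R + 2 * B) := by ring

end BurgersControl

end

/-! ### The estimate in terms of `C_state` -/

theorem mainTheorem11 (ν T : ℝ) (hν : 0 < ν) (hT : 0 < T)
    (χ : ℝ → ℝ) (hχ : ContDiff ℝ ∞ χ) (hχc : HasCompactSupport χ) :
    ∃ C₀ : ℝ, 0 < C₀ ∧ ∀ C : ℝ, C₀ ≤ C → ∀ δ : ℝ, 0 < δ → ∃ c : ℝ, 0 < c ∧
      ∀ (y₀ : BurgersControl.V) (yd : BurgersControl.H),
        BurgersControl.HasBoundedSupport (BurgersControl.toL2 y₀) → BurgersControl.HasBoundedSupport yd →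
      ∀ (ul uu : ℝ), ∀ u ∈ BurgersControl.admissible T ul uu,
        δ ≤ ‖BurgersControl.toL2 u‖ + ‖y₀‖ →
      ∀ (r : ℕ) (ζ : ℝ → ℝ), BurgersControl.IsKernel r ζ →
      ∀ (ε : ℝ), 0 < ε → ∀ (N : ℕ) (X : Fin N → ℝ)
        (y : BurgersControl.W T) (Φ : Fin N → BurgersControl.H1 (Ioo 0 T)),
        BurgersControl.IsDiscreteState ν χ ζ ε X y₀ u y Φ →
      ∀ (yT : BurgersControl.H), BurgersControl.ValueAt y T yT →
      ∀ (p : BurgersControl.W T), BurgersControl.IsDiscreteAdjoint ν yd yT y p →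
        ‖p‖ ≤ c * (BurgersControl.stateConst C u y₀ ^ 4 + BurgersControl.stateConst C u y₀ ^ 2)
          * ‖yT - yd‖ := by
  obtain ⟨κ, hκ, hκχ⟩ := BurgersControl.exists_pairing_bound hχ.continuous hχc
  set k : ℝ := 2 + 4 * T * κ ^ 2 with hk
  -- The exponent in `adjoint_norm_sq_le` is this first factor times `R`, and `R ≤ k * M` with `M =
  -- ‖u‖² + ‖y₀‖_H²`.
  set C₀ : ℝ := (1 + 8 / ν * (T + 1 / (2 * ν))) * k with hC₀
  have hkpos : 0 < k := by positivity
  have hC₀pos : 0 < C₀ := by positivity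
  set c₁ : ℝ := Real.sqrt (T + 9 / ν + 2 * ν) with hc₁
  have hc₁pos : 0 < c₁ := Real.sqrt_pos.2 (by positivity)
  refine ⟨C₀, hC₀pos, fun C hC δ hδ => ?_⟩
  have hCpos : 0 < C := hC₀pos.trans_le hC
  refine ⟨c₁ / (C ^ 2 * δ ^ 4), by positivity, ?_⟩
  intro y₀ yd _ _ ul uu u _ hu r ζ _ ε _ N X y Φ hy yT _ p hp
  obtain ⟨_, ⟨Y, hYc, hYy, rfl⟩, hY0⟩ := hy.init
  obtain ⟨_, ⟨P, hPc, hPp, rfl⟩, hPT⟩ := hp.terminal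
  have hY0' : Y 0 = BurgersControl.toL2 y₀ := ext_inner_right ℝ hY0
  have hPT' : P T = yd - yT := ext_inner_right ℝ hPT
  obtain ⟨h1, h2⟩ := BurgersControl.state_energy_estimate hν hT hκ hκχ hYc hYy hy.equation
  have h3 := BurgersControl.adjoint_norm_sq_le hν hT hYy h1 h2 hPc hPp hp.equation
  rw [hPT', norm_sub_rev, hY0'] at h3
  set M : ℝ := ‖BurgersControl.toL2 u‖ ^ 2 + ‖BurgersControl.toL2 y₀‖ ^ 2 with hM
  have hM0 : 0 ≤ M := by positivity
  have hRM : 2 * ‖BurgersControl.toL2 y₀‖ ^ 2 + 4 * T * κ ^ 2 * ‖BurgersControl.toL2 u‖ ^ 2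
      ≤ k * M := by
    have : 0 ≤ 4 * T * κ ^ 2 * ‖BurgersControl.toL2 y₀‖ ^ 2
      + 2 * ‖BurgersControl.toL2 u‖ ^ 2 := by positivity
    rw [hk, hM]; nlinarith
  have h4 : ‖p‖ ^ 2 ≤ (c₁ * Real.exp (C * M) * ‖yT - yd‖) ^ 2 := by
    refine h3.trans ?_
    have e1 : Real.exp ((1 + 8 / ν * (T + 1 / (2 * ν))) *
        (2 * ‖BurgersControl.toL2 y₀‖ ^ 2 + 4 * T * κ ^ 2 * ‖BurgersControl.toL2 u‖ ^ 2))
        ≤ Real.exp (C * M) ^ 2 := by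
      rw [← Real.exp_nat_mul]
      refine Real.exp_le_exp.2 ?_
      calc _ ≤ (1 + 8 / ν * (T + 1 / (2 * ν))) * (k * M) := by gcongr
        _ = C₀ * M := by rw [hC₀]; ring
        _ ≤ C * M := by gcongr
        _ ≤ _ := by push_cast; nlinarith [mul_nonneg hCpos.le hM0]
    rw [mul_pow, mul_pow, hc₁, Real.sq_sqrt (by positivity)]
    calc _ ≤ (T + 9 / ν + 2 * ν) * ‖yT - yd‖ ^ 2 * Real.exp (C * M) ^ 2 := by gcongr
      _ = _ := by ring
  have h5 : ‖p‖ ≤ c₁ * Real.exp (C * M) * ‖yT - yd‖ :=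
    (sq_le_sq₀ (norm_nonneg _) (by positivity)).1 h4
  refine h5.trans (mul_le_mul_of_nonneg_right ?_ (norm_nonneg _))
  -- The square of `C_state` already dominates the exponential; its prefactor is bounded below by
  -- `‖u‖ + ‖y₀‖_V ≥ δ`, and the fourth power only adds a nonnegative term.
  have h6 : C ^ 2 * δ ^ 4 * Real.exp (C * M) ≤ BurgersControl.stateConst C u y₀ ^ 2 := by
    rw [BurgersControl.stateConst, ← hM, mul_pow, mul_pow, ← pow_mul]
    have e2 : Real.exp (C * M) ≤ Real.exp (C * M) ^ 2 :=
      le_self_pow₀ (Real.one_le_exp (by positivity)) two_ne_zero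
    gcongr
  have h7 : 0 ≤ BurgersControl.stateConst C u y₀ ^ 4 := by positivity
  calc c₁ * Real.exp (C * M) = c₁ / (C ^ 2 * δ ^ 4) * (C ^ 2 * δ ^ 4 * Real.exp (C * M)) := by
        field
    _ ≤ c₁ / (C ^ 2 * δ ^ 4) * (BurgersControl.stateConst C u y₀ ^ 4
        + BurgersControl.stateConst C u y₀ ^ 2) := by
        gcongr
        linarith
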